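/- Let $A$ and $B$ be (possibly unbounded) self-adjoint operators in a complex Hilbert space $\mathcal H$ with domains $\mathcal D(A)$, $\mathcal D(B)$, and let $J$ be a bounded operator on $\mathcal H$. Let $E_\lambda$ be the spectral projectors of $B$, let $P_{ac}(B)$ be the orthogonal projection onto the absolutely continuous subspace of $B$ (the set of all $\varphi\in\mathcal H$ whose spectral measure $d(\varphi,E_\lambda\varphi)$ is absolutely continuous with respect to Lebesgue measure), and let $\mathcal M(B)$ be the set of all $\varphi\in\mathcal H$ such that $d(\varphi,E_\lambda\varphi)=|f(\lambda)|^2\,d\lambda$ for some $f\in L^\infty(\mathbb R)$. Suppose that $C=AJ-JB$ in the form sense, i.e. $C$ is an operator on $\mathcal H$ with $$(\varphi,C\psi)=(A\varphi,J\psi)-(\varphi,JB\psi)\qquad\text{for all }\varphi\in\mathcal D(A),\ \psi\in\mathcal D(B),$$ and that $C=C_1+C_2$, where $C_1$ is a trace class operator and $C_2$ is a bounded operator on $\mathcal H$. Suppose further that there is a subset $M\subset\mathcal M(B)$, dense in $\mathcal M(B)$ in the norm of $\mathcal H$, such that for every $\varphi\in M$ $$\lim_{t\to+\infty}C_2e^{-iBt}\varphi=0\qquad\text{and}\qquad\int_0^{+\infty}\|C_2e^{-iBt}\varphi\|\,dt<\infty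 .$$ Then the strong limit $$\Omega_{out}(A,B;J)=\operatorname*{s-lim}_{t\to+\infty}e^{iAt}Je^{-iBt}P_{ac}(B)$$ exists as a bounded operator on $\mathcal H$, i.e. $e^{iAt}Je^{-iBt}P_{ac}(B)\varphi$ converges in norm as $t\to+\infty$ for every $\varphi\in\mathcal H$. -/

import Mathlib

open MeasureTheory Filter Topology Set
open scoped InnerProductSpace ENNReal

noncomputable section

namespace Scattering

variable {H : Type*} [NormedAddCommGroup H] [InnerProductSpace ℂ H] [CompleteSpace H]

/-! ### Trace class operators -/

/-- `T` is trace class: `tr |T| < ∞`, where `|T| = (T* T)^(1/2)` and the trace (a sum of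
nonnegative terms that does not depend on the basis) is computed in an orthonormal basis. -/
def IsTraceClass (T : H →L[ℂ] H) : Prop :=
  ∃ (w : Set H) (b : HilbertBasis w ℂ H), Summable fun i => (⟪b i, CFC.abs T (b i)⟫_ℂ).re

/-! ### The unitary group of a self-adjoint operator -/

/-- `U` is the strongly continuous one-parameter unitary group `t ↦ e^{itB}`: its generator is
`iB`, that is, `φ ∈ D(B)` and `B φ = ψ` if and only if `t ↦ U t φ` has derivative `i ψ` at `0`. -/
structure IsUnitaryGroupOf (B : H →ₗ.[ℂ] H) (U : ℝ → H →L[ℂ] H) : Prop where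
  mem_unitary : ∀ t, U t ∈ unitary (H →L[ℂ] H)
  map_zero : U 0 = 1
  map_add : ∀ s t, U (s + t) = U s * U t
  continuous : ∀ φ, Continuous fun t => U t φ
  generator : ∀ φ ψ : H,
    (φ, ψ) ∈ B.graph ↔ HasDerivAt (fun t => U t φ) (Complex.I • ψ) 0

open Classical in
/-- The operator `e^{itB}`, for self-adjoint `B`. By Stone's theorem there is exactly one group as
in `IsUnitaryGroupOf` for every self-adjoint `B`, so the second branch does not occur then. -/
def expI (B : H →ₗ.[ℂ] H) (t : ℝ) : H →L[ℂ] H :=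
  if h : ∃ U : ℝ → H →L[ℂ] H, IsUnitaryGroupOf B U then h.choose t else 1

/-! ### Projection-valued measures and the spectral measure of a self-adjoint operator -/

/-- A projection-valued measure on the Borel sets of `ℝ`: orthogonal projections, countably
additive in the strong sense, of total mass `1`. -/
structure ProjMeasure (H : Type*) [NormedAddCommGroup H] [InnerProductSpace ℂ H]
    [CompleteSpace H] where
  proj : Set ℝ → H →L[ℂ] H
  isStarProjection : ∀ S, MeasurableSet S → IsStarProjection (proj S)
  not_measurable : ∀ S, ¬ MeasurableSet S → proj S = 0
  empty : proj ∅ = 0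
  univ : proj Set.univ = 1
  hasSum_iUnion : ∀ S : ℕ → Set ℝ, (∀ n, MeasurableSet (S n)) →
    Pairwise (Function.onFun Disjoint S) → ∀ φ : H,
      HasSum (fun n => proj (S n) φ) (proj (⋃ n, S n) φ)

namespace ProjMeasure

theorem inner_proj (E : ProjMeasure H) {S : Set ℝ} (hS : MeasurableSet S) (φ : H) :
    (⟪φ, E.proj S φ⟫_ℂ).re = ‖E.proj S φ‖ ^ 2 := by
  have h := E.isStarProjection S hS
  have h1 : E.proj S (E.proj S φ) = E.proj S φ :=
    congrArg (fun T : H →L[ℂ] H => T φ) h.isIdempotentElem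
  have h2 : ContinuousLinearMap.adjoint (E.proj S) = E.proj S := h.isSelfAdjoint
  have h3 : ⟪φ, E.proj S φ⟫_ℂ = ⟪E.proj S φ, E.proj S φ⟫_ℂ := by
    conv_lhs => rw [← h1, ← ContinuousLinearMap.adjoint_inner_left, h2]
  rw [h3, inner_self_eq_norm_sq_to_K]
  norm_cast

/-- The measure `d(φ, E_λ φ)`, that is, `S ↦ (φ, E(S) φ)`. -/
def scalar (E : ProjMeasure H) (φ : H) : Measure ℝ :=
  Measure.ofMeasurable (fun S _ => ENNReal.ofReal (⟪φ, E.proj S φ⟫_ℂ).re)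
    (by simp [E.empty])
    (by
      intro S hS hd
      have h := E.hasSum_iUnion S hS hd φ
      have h' : HasSum (fun n => (⟪φ, E.proj (S n) φ⟫_ℂ).re)
          (⟪φ, E.proj (⋃ n, S n) φ⟫_ℂ).re :=
        h.mapL ((Complex.reCLM).comp ((innerSL ℂ φ).restrictScalars ℝ))
      rw [← h'.tsum_eq, ENNReal.ofReal_tsum_of_nonneg _ h'.summable]
      intro n
      rw [E.inner_proj (hS n)]
      positivity)

theorem scalar_apply (E : ProjMeasure H) (φ : H) {S : Set ℝ} (hS : MeasurableSet S) :
    E.scalar φ S = ENNReal.ofReal (⟪φ, E.proj S φ⟫_ℂ).re :=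
  Measure.ofMeasurable_apply S hS

theorem scalar_apply_eq_zero (E : ProjMeasure H) (φ : H) {S : Set ℝ} (hS : MeasurableSet S) :
    E.scalar φ S = 0 ↔ E.proj S φ = 0 := by
  rw [E.scalar_apply φ hS, E.inner_proj hS, ENNReal.ofReal_eq_zero]
  constructor
  · intro h
    have : ‖E.proj S φ‖ = 0 := by nlinarith [norm_nonneg (E.proj S φ)]
    simpa using this
  · intro h
    simp [h]

theorem scalar_ac_iff (E : ProjMeasure H) (φ : H) :
    E.scalar φ ≪ volume ↔
      ∀ S, MeasurableSet S → volume S = 0 → E.proj S φ = 0 := by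
  constructor
  · intro h S hS h0
    exact (E.scalar_apply_eq_zero φ hS).1 (h h0)
  · intro h
    refine Measure.AbsolutelyContinuous.mk fun S hS h0 => ?_
    exact (E.scalar_apply_eq_zero φ hS).2 (h S hS h0)

open Classical in
/-- The point mass at `0`: the spectral measure of the zero operator. -/
instance : Inhabited (ProjMeasure H) where
  default :=
    { proj := fun S => if MeasurableSet S ∧ (0 : ℝ) ∈ S then 1 else 0
      isStarProjection := by
        intro S _
        split_ifs
        · exact IsStarProjection.one _
        · exact IsStarProjection.zero _
      not_measurable := by
        intro S hS
        simp [hS]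
      empty := by simp
      univ := by simp
      hasSum_iUnion := by
        intro S hS hd φ
        by_cases h : ∃ n, (0 : ℝ) ∈ S n
        · obtain ⟨n, hn⟩ := h
          have hU : (0 : ℝ) ∈ ⋃ k, S k := mem_iUnion.2 ⟨n, hn⟩
          have hS' : MeasurableSet (⋃ k, S k) := MeasurableSet.iUnion hS
          have := hasSum_single (f := fun k =>
            (if MeasurableSet (S k) ∧ (0 : ℝ) ∈ S k then (1 : H →L[ℂ] H) else 0) φ) n (by
              intro k hk
              have : (0 : ℝ) ∉ S k := fun h0 => Set.disjoint_left.1 (hd hk) h0 hn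
              simp [this])
          rw [if_pos ⟨hS', hU⟩]
          convert this using 1
          simp [hS n, hn]
        · have hU : (0 : ℝ) ∉ ⋃ k, S k := by simpa using h
          push Not at h
          simp [h] }

end ProjMeasure

/-- `B = ∫ λ dE_λ`: the domain of `B` is `{φ | ∫ λ² d(φ, E_λ φ) < ∞}`, and
`(φ, B φ) = ∫ λ d(φ, E_λ φ)` for all `φ` in it (which determines `B` by polarization). -/
structure IsSpectralMeasureOf (B : H →ₗ.[ℂ] H) (E : ProjMeasure H) : Prop where
  mem_domain_iff : ∀ φ, φ ∈ B.domain ↔ ∫⁻ x, ENNReal.ofReal (x ^ 2) ∂(E.scalar φ) < ∞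
  inner_apply : ∀ φ : B.domain, ⟪(φ : H), B φ⟫_ℂ = ((∫ x, x ∂(E.scalar (φ : H)) : ℝ) : ℂ)

open Classical in
/-- The spectral measure `E` of a self-adjoint operator `B`; the spectral projectors are
`E_λ = E((-∞, λ])`. By the spectral theorem there is exactly one `E` as in `IsSpectralMeasureOf`
for every self-adjoint `B`, so the second branch does not occur then. -/
def spectralMeasure (B : H →ₗ.[ℂ] H) : ProjMeasure H :=
  if h : ∃ E : ProjMeasure H, IsSpectralMeasureOf B E then h.choose else default

/-- The set `𝓜(B)` of all `φ` with `d(φ, E_λ φ) = |f(λ)|² dλ` for some `f ∈ L^∞(ℝ)`. -/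
def boundedDensitySet (B : H →ₗ.[ℂ] H) : Set H :=
  {φ | ∃ f : ℝ → ℂ, MemLp f ∞ volume ∧
    (spectralMeasure B).scalar φ = volume.withDensity fun x => ‖f x‖ₑ ^ 2}

/-- The absolutely continuous subspace of `B`: all `φ` for which `d(φ, E_λ φ)` is absolutely
continuous with respect to Lebesgue measure. -/
def acSubspace (B : H →ₗ.[ℂ] H) : Submodule ℂ H where
  carrier := {φ | (spectralMeasure B).scalar φ ≪ volume}
  zero_mem' := by
    simp only [mem_ofPred_eq, ProjMeasure.scalar_ac_iff]
    intro S _ _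
    exact _root_.map_zero _
  add_mem' := by
    intro φ ψ hφ hψ
    simp only [mem_ofPred_eq, ProjMeasure.scalar_ac_iff] at *
    intro S hS h0
    rw [_root_.map_add, hφ S hS h0, hψ S hS h0, add_zero]
  smul_mem' := by
    intro c φ hφ
    simp only [mem_ofPred_eq, ProjMeasure.scalar_ac_iff] at *
    intro S hS h0
    rw [map_smul, hφ S hS h0, smul_zero]

theorem isClosed_acSubspace (B : H →ₗ.[ℂ] H) : IsClosed (acSubspace B : Set H) := by
  have : (acSubspace B : Set H) = ⋂ (S : Set ℝ) (_ : MeasurableSet S) (_ : volume S = 0),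
      {φ | (spectralMeasure B).proj S φ = 0} := by
    ext φ
    simp only [mem_iInter, mem_ofPred_eq]
    exact ProjMeasure.scalar_ac_iff _ φ
  rw [this]
  refine isClosed_iInter fun S => isClosed_iInter fun _ => isClosed_iInter fun _ => ?_
  exact isClosed_eq (ContinuousLinearMap.continuous _) continuous_const

instance (B : H →ₗ.[ℂ] H) : CompleteSpace (acSubspace B) :=
  (isClosed_acSubspace B).completeSpace_coe

/-- `P_ac(B)`: the orthogonal projection onto the absolutely continuous subspace. -/
def acProj (B : H →ₗ.[ℂ] H) : H →L[ℂ] H :=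
  (acSubspace B).starProjection

end Scattering

end

/-! The operators e^{iAt} J e^{-iBt} are bounded by ‖J‖ uniformly in t, so it is enough to prove
convergence on a set whose closure contains the absolutely continuous subspace. Truncating spectral
densities shows that 𝓜(B), and hence M, is such a set (`acSubspace_subset_closure`).

For φ in M put u(t) = e^{-iBt} φ and w(t) = e^{iAt} J u(t). Then w' = i k with k(t) = e^{iAt} C u(t)
(`hasDerivAt_wave`). The C₂ part of k is integrable in norm, which is Cook's method. The trace class
part only gives square integrability in time, and Pearson's trick makes up for this: for fixed s, t
the difference w(t+N) - w(s+N) tends to 0, so ‖w(t) - w(s)‖² is controlled by the derivative of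
‖w(t+a) - w(s+a)‖² integrated over a in [0, N]. That derivative is built from terms ⟨w(x), k(y)⟩ =
⟨e^{iA(x-y)} J u(x), C u(y)⟩. Factor C₁ = G D with G and D Hilbert-Schmidt
(`IsTraceClass.exists_factor`). The C₁ part becomes ⟨G* e^{iA(x-y)} J u(x), D u(y)⟩, where both
entries are square integrable along a time translation, the first with a bound independent of x - y
and the second with a small tail. The C₂ part is at most ‖J‖ ‖φ‖ ‖C₂ u(y)‖, again with a small tail.
The resulting Cauchy estimate is `exists_tendsto_of_inner_bound`.

Square integrability rests on ∫ |⟨η, u(t)⟩|² dt ≤ c ‖η‖² for bounded spectral density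
(`lintegral_inner_expI_sq_le`), which is dual to a Plancherel inequality; summing over an
orthonormal basis passes to Hilbert-Schmidt operators.

Since `expI` and `spectralMeasure` are defined by choice, the spectral theorem and Stone's theorem
have to be supplied. The resolvent (A + i)⁻¹ is normal; its continuous functional calculus and Riesz
representation give measures on its spectrum, which are carried to the real line
(`exists_isSpectralMeasureOf`). Integrating e^{itx} gives the group. One extension procedure,
`IsCalculus`, serves twice: for continuous functions on the spectrum and for simple functions on the
line. -/

noncomputable section

namespace Scattering

set_option linter.unusedSectionVars false

variable {H : Type*} [NormedAddCommGroup H] [InnerProductSpace ℂ H] [CompleteSpace H]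

/-! ### Extension of a functional calculus to square integrable functions -/

section Calculus

variable {X D : Type*} [MeasurableSpace X] [AddCommGroup D] [Module ℂ D]

theorem tendsto_zero_of_le {u v : ℕ → ℝ≥0∞} (hv : Tendsto v atTop (𝓝 0)) (h : ∀ n, u n ≤ v n) :
    Tendsto u atTop (𝓝 0) :=
  tendsto_of_tendsto_of_tendsto_of_le_of_le tendsto_const_nhds hv (fun _ => zero_le) h

/-- A linear family of operators `π d`, indexed by functions `j d` that are dense in `L²` for
every finite measure, such that `‖π d φ‖` is the norm of `j d` in `L²(μ φ)`. -/
structure IsCalculus (μ : H → Measure X) (j : D →ₗ[ℂ] X → ℂ) (π : D →ₗ[ℂ] H →L[ℂ] H) :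
    Prop where
  finite : ∀ φ, IsFiniteMeasure (μ φ)
  memLp : ∀ d φ, MemLp (j d) 2 (μ φ)
  dense : ∀ (ν : Measure X) [IsFiniteMeasure ν] (f : X → ℂ), MemLp f 2 ν → ∀ ε : ℝ≥0∞, ε ≠ 0 →
    ∃ d, eLpNorm (f - j d) 2 ν ≤ ε
  enorm_apply : ∀ d φ, ‖π d φ‖ₑ = eLpNorm (j d) 2 (μ φ)
  exists_one : ∃ u, j u = 1 ∧ π u = 1

/-- `ψ` is the vector `f φ` of the extended calculus. -/
def Rep (μ : H → Measure X) (j : D →ₗ[ℂ] X → ℂ) (π : D →ₗ[ℂ] H →L[ℂ] H)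
    (φ : H) (f : X → ℂ) (ψ : H) : Prop :=
  MemLp f 2 (μ φ) ∧ ∃ d : ℕ → D,
    Tendsto (fun n => eLpNorm (f - j (d n)) 2 (μ φ)) atTop (𝓝 0) ∧
    Tendsto (fun n => π (d n) φ) atTop (𝓝 ψ)

variable {μ : H → Measure X} {j : D →ₗ[ℂ] X → ℂ} {π : D →ₗ[ℂ] H →L[ℂ] H}

theorem IsCalculus.exists_approx (h : IsCalculus μ j π) (ν : Measure X) [IsFiniteMeasure ν]
    {f : X → ℂ} (hf : MemLp f 2 ν) :
    ∃ d : ℕ → D, Tendsto (fun n => eLpNorm (f - j (d n)) 2 ν) atTop (𝓝 0) := by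
  choose d hd using fun n : ℕ => h.dense ν f hf ((n : ℝ≥0∞)⁻¹) (by simp)
  exact ⟨d, tendsto_zero_of_le ENNReal.tendsto_inv_nat_nhds_zero hd⟩

theorem IsCalculus.enorm_sub_le (h : IsCalculus μ j π) (φ : H) {f : X → ℂ}
    (hf : MemLp f 2 (μ φ)) (d e : D) :
    ‖π d φ - π e φ‖ₑ ≤ eLpNorm (f - j d) 2 (μ φ) + eLpNorm (f - j e) 2 (μ φ) := by
  have h1 : π d φ - π e φ = π (d - e) φ := by simp
  have h2 : j (d - e) = (f - j e) - (f - j d) := by simp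
  rw [h1, h.enorm_apply, h2, add_comm]
  exact eLpNorm_sub_le (hf.sub (h.memLp e φ)).1 (hf.sub (h.memLp d φ)).1 (by norm_num)

/-- Two sequences approximating f in L²(μ φ) approach each other there, and `enorm_apply` turns this
into closeness of the vectors. So the limit does not depend on the sequence. -/
theorem Rep.tendsto (h : IsCalculus μ j π) {φ ψ : H} {f : X → ℂ} (hr : Rep μ j π φ f ψ)
    {e : ℕ → D} (he : Tendsto (fun n => eLpNorm (f - j (e n)) 2 (μ φ)) atTop (𝓝 0)) :
    Tendsto (fun n => π (e n) φ) atTop (𝓝 ψ) := by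
  obtain ⟨hf, d, hd, hd'⟩ := hr
  have h0 : Tendsto (fun n => π (e n) φ - π (d n) φ) atTop (𝓝 0) := by
    rw [tendsto_zero_iff_enorm_tendsto_zero]
    exact tendsto_zero_of_le (by simpa using he.add hd) fun n => h.enorm_sub_le φ hf (e n) (d n)
  simpa using h0.add hd'

theorem Rep.exists (h : IsCalculus μ j π) (φ : H) {f : X → ℂ} (hf : MemLp f 2 (μ φ)) :
    ∃ ψ, Rep μ j π φ f ψ := by
  have := h.finite φ
  obtain ⟨d, hd⟩ := h.exists_approx (μ φ) hf
  have hc : CauchySeq (fun n => π (d n) φ) := by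
    rw [EMetric.cauchySeq_iff]
    intro ε hε
    have hε2 : 0 < ε / 2 := ENNReal.half_pos hε.ne'
    obtain ⟨N, hN⟩ := eventually_atTop.1 (hd.eventually (gt_mem_nhds hε2))
    refine ⟨N, fun m hm n hn => ?_⟩
    rw [edist_eq_enorm_sub]
    calc _ ≤ _ := h.enorm_sub_le φ hf (d m) (d n)
      _ < ε / 2 + ε / 2 := ENNReal.add_lt_add (hN m hm) (hN n hn)
      _ = ε := ENNReal.add_halves ε
  obtain ⟨ψ, hψ⟩ := cauchySeq_tendsto_of_complete hc
  exact ⟨ψ, hf, d, hd, hψ⟩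

theorem Rep.unique (h : IsCalculus μ j π) {φ ψ ψ' : H} {f : X → ℂ} (h₁ : Rep μ j π φ f ψ)
    (h₂ : Rep μ j π φ f ψ') : ψ = ψ' := by
  obtain ⟨_, d, hd, hd'⟩ := h₂
  exact tendsto_nhds_unique (h₁.tendsto h hd) hd'

theorem Rep.congr_ae {φ ψ : H} {f g : X → ℂ} (h₁ : Rep μ j π φ f ψ)
    (hfg : f =ᵐ[μ φ] g) : Rep μ j π φ g ψ := by
  obtain ⟨hf, d, hd, hd'⟩ := h₁
  refine ⟨hf.ae_eq hfg, d, hd.congr fun n => ?_, hd'⟩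
  exact eLpNorm_congr_ae (hfg.sub (ae_eq_refl _))

theorem Rep.add (h : IsCalculus μ j π) {φ ψ χ : H} {f g : X → ℂ} (h₁ : Rep μ j π φ f ψ)
    (h₂ : Rep μ j π φ g χ) : Rep μ j π φ (f + g) (ψ + χ) := by
  obtain ⟨hf, d, hd, hd'⟩ := h₁
  obtain ⟨hg, e, he, he'⟩ := h₂
  refine ⟨hf.add hg, fun n => d n + e n, ?_, by simpa using hd'.add he'⟩
  refine tendsto_zero_of_le (v := fun n => eLpNorm (f - j (d n)) 2 (μ φ) +
    eLpNorm (g - j (e n)) 2 (μ φ)) (by simpa using hd.add he) fun n => ?_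
  · have : f + g - j (d n + e n) = (f - j (d n)) + (g - j (e n)) := by
      rw [map_add]; abel
    simp only [this]
    exact eLpNorm_add_le (hf.sub (h.memLp _ φ)).1 (hg.sub (h.memLp _ φ)).1 (by norm_num)

theorem Rep.smul {φ ψ : H} {f : X → ℂ} (c : ℂ)
    (h₁ : Rep μ j π φ f ψ) : Rep μ j π φ (c • f) (c • ψ) := by
  obtain ⟨hf, d, hd, hd'⟩ := h₁
  refine ⟨hf.const_smul c, fun n => c • d n, ?_, by simpa using hd'.const_smul c⟩
  have : ∀ n, eLpNorm (c • f - j (c • d n)) 2 (μ φ) = ‖c‖ₑ * eLpNorm (f - j (d n)) 2 (μ φ) := by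
    intro n
    rw [map_smul, ← smul_sub, eLpNorm_const_smul]
  simp only [this]
  simpa using ENNReal.Tendsto.const_mul hd (Or.inr (by simp))

theorem Rep.sub (h : IsCalculus μ j π) {φ ψ χ : H} {f g : X → ℂ} (h₁ : Rep μ j π φ f ψ)
    (h₂ : Rep μ j π φ g χ) : Rep μ j π φ (f - g) (ψ - χ) := by
  have := h₁.add h (h₂.smul (-1))
  simpa [← sub_eq_add_neg] using this

theorem Rep.one (h : IsCalculus μ j π) (φ : H) : Rep μ j π φ 1 φ := by
  obtain ⟨u, hu, hu'⟩ := h.exists_one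
  refine ⟨hu ▸ h.memLp u φ, fun _ => u, ?_, ?_⟩
  · simp [hu]
  · simp [hu']

theorem Rep.of_mem (h : IsCalculus μ j π) (d : D) (φ : H) : Rep μ j π φ (j d) (π d φ) :=
  ⟨h.memLp d φ, fun _ => d, by simp, tendsto_const_nhds⟩

theorem Rep.enorm_eq (h : IsCalculus μ j π) {φ ψ : H} {f : X → ℂ} (hr : Rep μ j π φ f ψ) :
    ‖ψ‖ₑ = eLpNorm f 2 (μ φ) := by
  obtain ⟨hf, d, hd, hd'⟩ := hr
  have h1 : Tendsto (fun n => ‖π (d n) φ‖ₑ) atTop (𝓝 ‖ψ‖ₑ) := hd'.enorm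
  simp only [h.enorm_apply] at h1
  have h2 : Tendsto (fun n => eLpNorm f 2 (μ φ) + eLpNorm (f - j (d n)) 2 (μ φ)) atTop
      (𝓝 (eLpNorm f 2 (μ φ))) := by simpa using tendsto_const_nhds.add hd
  have h3 : Tendsto (fun n => eLpNorm (j (d n)) 2 (μ φ) + eLpNorm (f - j (d n)) 2 (μ φ)) atTop
      (𝓝 ‖ψ‖ₑ) := by simpa using h1.add hd
  refine le_antisymm (le_of_tendsto_of_tendsto' h1 h2 fun n => ?_)
    (ge_of_tendsto' h3 fun n => ?_)
  · calc _ = eLpNorm (f - (f - j (d n))) 2 (μ φ) := by simp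
      _ ≤ _ := eLpNorm_sub_le hf.1 (hf.sub (h.memLp _ φ)).1 (by norm_num)
  · calc _ = eLpNorm (j (d n) + (f - j (d n))) 2 (μ φ) := by simp
      _ ≤ _ := eLpNorm_add_le (h.memLp _ φ).1 (hf.sub (h.memLp _ φ)).1 (by norm_num)

theorem Rep.norm_sq_eq (h : IsCalculus μ j π) {φ ψ : H} {f : X → ℂ} (hr : Rep μ j π φ f ψ) :
    ‖ψ‖ ^ 2 = ∫ x, ‖f x‖ ^ 2 ∂(μ φ) := by
  have h1 := hr.enorm_eq h
  have h2 : ‖ψ‖ = (eLpNorm f 2 (μ φ)).toReal := by rw [← h1, toReal_enorm]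
  rw [h2, hr.1.eLpNorm_eq_integral_rpow_norm (by norm_num) (by norm_num),
    ENNReal.toReal_ofReal (by positivity)]
  simp only [ENNReal.toReal_ofNat, Real.rpow_ofNat]
  rw [← Real.rpow_natCast, ← Real.rpow_mul (by positivity)]
  norm_num

/-- Polarization of `Rep.norm_sq_eq`, applied to the vectors and pointwise to the functions. -/
theorem Rep.inner_eq (h : IsCalculus μ j π) {φ ψ χ : H} {f g : X → ℂ} (h₁ : Rep μ j π φ f ψ)
    (h₂ : Rep μ j π φ g χ) : ⟪ψ, χ⟫_ℂ = ∫ x, (starRingEnd ℂ) (f x) * g x ∂(μ φ) := by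
  have hI : Rep μ j π φ (Complex.I • g) (Complex.I • χ) := h₂.smul _
  have i1 : ∀ {u : X → ℂ}, MemLp u 2 (μ φ) → Integrable (fun x => ((‖u x‖ ^ 2 : ℝ) : ℂ)) (μ φ) :=
    fun hu => ((memLp_two_iff_integrable_sq_norm hu.1).1 hu).ofReal
  have e1 : ∀ {u : X → ℂ} {v : H}, Rep μ j π φ u v →
      ((‖v‖ : ℂ) ^ 2) = ∫ x, ((‖u x‖ ^ 2 : ℝ) : ℂ) ∂(μ φ) := by
    intro u v huv
    rw [integral_complex_ofReal, ← huv.norm_sq_eq h]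
    norm_cast
  have r1 := h₁.add h h₂
  have r2 := h₁.sub h h₂
  have r3 := h₁.sub h hI
  have r4 := h₁.add h hI
  rw [inner_eq_sum_norm_sq_div_four]
  simp only [RCLike.I_to_complex, Complex.coe_algebraMap]
  rw [e1 r1, e1 r2, e1 r3, e1 r4, ← integral_sub (i1 r1.1) (i1 r2.1),
    ← integral_sub (i1 r3.1) (i1 r4.1), ← integral_mul_const]
  refine ((congrArg (· / (4 : ℂ)) (integral_add ((i1 r1.1).sub (i1 r2.1))
    (((i1 r3.1).sub (i1 r4.1)).mul_const Complex.I)).symm)).trans ?_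
  rw [← integral_div]
  congr 1
  ext x
  have := inner_eq_sum_norm_sq_div_four (𝕜 := ℂ) (f x) (g x)
  simp only [RCLike.I_to_complex, Complex.coe_algebraMap] at this
  rw [RCLike.inner_apply'] at this
  simp only [Pi.add_apply, Pi.sub_apply, Pi.smul_apply]
  push_cast
  exact this.symm

theorem Rep.inner_left_eq (h : IsCalculus μ j π) {φ ψ : H} {f : X → ℂ}
    (hr : Rep μ j π φ f ψ) : ⟪φ, ψ⟫_ℂ = ∫ x, f x ∂(μ φ) := by
  simpa using (Rep.one h φ).inner_eq h hr

theorem memLp_add_measure {f : X → ℂ} {ν ρ : Measure X} (h₁ : MemLp f 2 ν) (h₂ : MemLp f 2 ρ) :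
    MemLp f 2 (ν + ρ) := by
  rw [memLp_two_iff_integrable_sq_norm (h₁.1.add_measure h₂.1)]
  exact ((memLp_two_iff_integrable_sq_norm h₁.1).1 h₁).add_measure
    ((memLp_two_iff_integrable_sq_norm h₂.1).1 h₂)

/-- A single sequence must approximate f for φ, φ' and φ + φ' at once; it is chosen in L² of the sum
of the three measures. This is why `IsCalculus` asks for density with respect to every finite
measure. -/
theorem Rep.add_vector (h : IsCalculus μ j π) {φ φ' ψ ψ' : H} {f : X → ℂ}
    (h₁ : Rep μ j π φ f ψ) (h₂ : Rep μ j π φ' f ψ') (hf : MemLp f 2 (μ (φ + φ'))) :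
    Rep μ j π (φ + φ') f (ψ + ψ') := by
  have := h.finite φ
  have := h.finite φ'
  have := h.finite (φ + φ')
  have hν : MemLp f 2 (μ φ + μ φ' + μ (φ + φ')) :=
    memLp_add_measure (memLp_add_measure h₁.1 h₂.1) hf
  obtain ⟨d, hd⟩ := h.exists_approx _ hν
  have key : ∀ ρ : Measure X, ρ ≤ μ φ + μ φ' + μ (φ + φ') →
      Tendsto (fun n => eLpNorm (f - j (d n)) 2 ρ) atTop (𝓝 0) := fun ρ hρ =>
    tendsto_zero_of_le hd fun n => eLpNorm_mono_measure _ hρ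
  refine ⟨hf, d, key _ (Measure.le_add_left le_rfl), ?_⟩
  simp only [_root_.map_add]
  exact (h₁.tendsto h (key _ (Measure.le_add_right (Measure.le_add_right le_rfl)))).add
    (h₂.tendsto h (key _ (Measure.le_add_right (Measure.le_add_left le_rfl))))

theorem Rep.smul_vector (h : IsCalculus μ j π) {φ ψ : H} {f : X → ℂ} (c : ℂ)
    (h₁ : Rep μ j π φ f ψ) (hf : MemLp f 2 (μ (c • φ))) :
    Rep μ j π (c • φ) f (c • ψ) := by
  have := h.finite φ
  have := h.finite (c • φ)
  have hν : MemLp f 2 (μ φ + μ (c • φ)) := memLp_add_measure h₁.1 hf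
  obtain ⟨d, hd⟩ := h.exists_approx _ hν
  have key : ∀ ρ : Measure X, ρ ≤ μ φ + μ (c • φ) →
      Tendsto (fun n => eLpNorm (f - j (d n)) 2 ρ) atTop (𝓝 0) := fun ρ hρ =>
    tendsto_zero_of_le hd fun n => eLpNorm_mono_measure _ hρ
  refine ⟨hf, d, key _ (Measure.le_add_left le_rfl), ?_⟩
  simp only [map_smul]
  exact (h₁.tendsto h (key _ (Measure.le_add_right le_rfl))).const_smul c

/-- Bounded measurable functions. -/
def IsBddMeas (f : X → ℂ) : Prop := Measurable f ∧ ∃ c : ℝ, ∀ x, ‖f x‖ ≤ c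

theorem IsBddMeas.memLp {f : X → ℂ} (hf : IsBddMeas f) (p : ℝ≥0∞) (ν : Measure X)
    [IsFiniteMeasure ν] : MemLp f p ν := by
  obtain ⟨c, hc⟩ := hf.2
  exact MemLp.of_bound hf.1.aestronglyMeasurable c (ae_of_all _ hc)

theorem IsBddMeas.mul {f g : X → ℂ} (hf : IsBddMeas f) (hg : IsBddMeas g) :
    IsBddMeas (f * g) := by
  obtain ⟨c, hc⟩ := hf.2
  obtain ⟨d, hd⟩ := hg.2
  refine ⟨hf.1.mul hg.1, c * d, fun x => ?_⟩
  rw [Pi.mul_apply, norm_mul]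
  exact mul_le_mul (hc x) (hd x) (norm_nonneg _) ((norm_nonneg _).trans (hc x))

theorem IsBddMeas.star {f : X → ℂ} (hf : IsBddMeas f) :
    IsBddMeas (fun x => (starRingEnd ℂ) (f x)) :=
  ⟨Complex.continuous_conj.measurable.comp hf.1, hf.2.imp fun c hc x => by simpa using hc x⟩

theorem IsBddMeas.const (c : ℂ) : IsBddMeas (fun _ : X => c) :=
  ⟨measurable_const, ‖c‖, fun _ => le_rfl⟩

theorem isBddMeas_one : IsBddMeas (1 : X → ℂ) := IsBddMeas.const 1

theorem isBddMeas_indicator {S : Set X} (hS : MeasurableSet S) :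
    IsBddMeas (S.indicator (1 : X → ℂ)) :=
  ⟨measurable_one.indicator hS, 1, fun x => by
    by_cases hx : x ∈ S <;> simp [hx]⟩

theorem IsCalculus.norm_sq_eq (h : IsCalculus μ j π) (φ : H) :
    ‖φ‖ ^ 2 = (μ φ).real univ := by
  simpa using (Rep.one h φ).norm_sq_eq h

theorem IsCalculus.exists_op (h : IsCalculus μ j π) {f : X → ℂ} (hf : IsBddMeas f) :
    ∃ T : H →L[ℂ] H, ∀ φ, Rep μ j π φ f (T φ) := by
  have hm : ∀ φ, MemLp f 2 (μ φ) := fun φ => by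
    have := h.finite φ
    exact hf.memLp _ _
  choose T hT using fun φ => Rep.exists h φ (hm φ)
  let L : H →ₗ[ℂ] H :=
    { toFun := T
      map_add' := fun φ ψ => (hT (φ + ψ)).unique h ((hT φ).add_vector h (hT ψ) (hm _))
      map_smul' := fun c φ => (hT (c • φ)).unique h ((hT φ).smul_vector h c (hm _)) }
  obtain ⟨c, hc⟩ := hf.2
  refine ⟨L.mkContinuous |c| fun φ => ?_, hT⟩
  have := h.finite φ
  change ‖T φ‖ ≤ |c| * ‖φ‖
  rw [← abs_of_nonneg (norm_nonneg (T φ)), ← abs_of_nonneg (norm_nonneg φ), ← abs_mul,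
    ← sq_le_sq, mul_pow, (hT φ).norm_sq_eq h, h.norm_sq_eq φ]
  calc ∫ x, ‖f x‖ ^ 2 ∂(μ φ) ≤ ∫ x, c ^ 2 ∂(μ φ) := by
        refine integral_mono_of_nonneg (ae_of_all _ fun x => by positivity) (integrable_const _)
          (ae_of_all _ fun x => ?_)
        exact pow_le_pow_left₀ (norm_nonneg _) (hc x) 2
    _ = c ^ 2 * (μ φ).real univ := by simp [mul_comm]

open Classical in
/-- The operator of a bounded measurable function in the extended calculus. -/
def op (μ : H → Measure X) (j : D →ₗ[ℂ] X → ℂ) (π : D →ₗ[ℂ] H →L[ℂ] H) (f : X → ℂ) :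
    H →L[ℂ] H :=
  if h : ∃ T : H →L[ℂ] H, ∀ φ, Rep μ j π φ f (T φ) then h.choose else 0

theorem rep_op (h : IsCalculus μ j π) {f : X → ℂ} (hf : IsBddMeas f) (φ : H) :
    Rep μ j π φ f (op μ j π f φ) := by
  have h' := h.exists_op hf
  rw [op, dif_pos h']
  exact h'.choose_spec φ

theorem op_eq_of_rep (h : IsCalculus μ j π) {f : X → ℂ} (hf : IsBddMeas f) {T : H →L[ℂ] H}
    (hT : ∀ φ, Rep μ j π φ f (T φ)) : op μ j π f = T :=
  ContinuousLinearMap.ext fun φ => (rep_op h hf φ).unique h (hT φ)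

theorem op_one (h : IsCalculus μ j π) : op μ j π 1 = 1 :=
  op_eq_of_rep h isBddMeas_one fun φ => Rep.one h φ

theorem op_coe (h : IsCalculus μ j π) (d : D) (hd : IsBddMeas (j d)) :
    op μ j π (j d) = π d :=
  op_eq_of_rep h hd fun φ => Rep.of_mem h d φ

theorem ext_inner_self {S T : H →L[ℂ] H} (h : ∀ φ, ⟪φ, S φ⟫_ℂ = ⟪φ, T φ⟫_ℂ) : S = T := by
  have : (S : H →ₗ[ℂ] H) = T := (ext_inner_map _ _).1 fun φ => by
    rw [← inner_conj_symm]
    conv_rhs => rw [← inner_conj_symm]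
    exact congrArg _ (h φ)
  exact ContinuousLinearMap.coe_injective this

theorem inner_op (h : IsCalculus μ j π) {f : X → ℂ} (hf : IsBddMeas f) (φ : H) :
    ⟪φ, op μ j π f φ⟫_ℂ = ∫ x, f x ∂(μ φ) :=
  (rep_op h hf φ).inner_left_eq h

theorem op_eq_of_inner (h : IsCalculus μ j π) {f : X → ℂ} (hf : IsBddMeas f) {T : H →L[ℂ] H}
    (hT : ∀ φ, ⟪φ, T φ⟫_ℂ = ∫ x, f x ∂(μ φ)) : op μ j π f = T :=
  ext_inner_self fun φ => by rw [inner_op h hf, hT]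

theorem op_star (h : IsCalculus μ j π) {f : X → ℂ} (hf : IsBddMeas f) :
    op μ j π (fun x => (starRingEnd ℂ) (f x)) = ContinuousLinearMap.adjoint (op μ j π f) := by
  refine op_eq_of_inner h hf.star fun φ => ?_
  rw [ContinuousLinearMap.adjoint_inner_right, integral_conj, ← inner_op h hf, inner_conj_symm]

/-- Multiplicativity need not be assumed of π: ⟨φ, f g φ⟩ = ⟨f̄ φ, g φ⟩ = ∫ f g dμ by polarization,
and a bounded operator is determined by its quadratic form. -/
theorem op_mul (h : IsCalculus μ j π) {f g : X → ℂ} (hf : IsBddMeas f) (hg : IsBddMeas g) :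
    op μ j π (f * g) = op μ j π f * op μ j π g := by
  refine op_eq_of_inner h (hf.mul hg) fun φ => ?_
  rw [mul_apply_eq_comp, ← ContinuousLinearMap.adjoint_inner_left, ← op_star h hf,
    (rep_op h hf.star φ).inner_eq h (rep_op h hg φ)]
  simp

end Calculus

/-! ### The functional calculus of a projection-valued measure -/

namespace ProjMeasure

variable (E : ProjMeasure H)

theorem proj_union {S T : Set ℝ} (hS : MeasurableSet S) (hT : MeasurableSet T)
    (hd : Disjoint S T) : E.proj (S ∪ T) = E.proj S + E.proj T := by
  ext φ
  let f : ℕ → Set ℝ := fun n => if n = 0 then S else if n = 1 then T else ∅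
  have hU : ⋃ n, f n = S ∪ T := by
    ext x
    simp only [mem_iUnion, mem_union, f]
    constructor
    · rintro ⟨n, hn⟩
      split_ifs at hn
      · exact Or.inl hn
      · exact Or.inr hn
      · exact absurd hn (notMem_empty x)
    · rintro (h | h)
      · exact ⟨0, by simpa using h⟩
      · exact ⟨1, by simpa using h⟩
  have h1 := E.hasSum_iUnion f (fun n => by
      simp only [f]; split_ifs <;> simp [hS, hT]) (by
      intro m n hmn
      simp only [Function.onFun, f]
      split_ifs <;> simp_all [disjoint_comm]) φ
  have h2 : HasSum (fun n => E.proj (f n) φ) (∑ n ∈ Finset.range 2, E.proj (f n) φ) := by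
    refine hasSum_sum_of_ne_finset_zero fun n hn => ?_
    have : ¬ n < 2 := by simpa using hn
    have h0 : n ≠ 0 := by omega
    have h1 : n ≠ 1 := by omega
    simp [f, h0, h1, E.empty]
  have := h1.unique h2
  rw [hU] at this
  simpa [Finset.sum_range_succ, f] using this

/-- The sum of projections P + Q is again idempotent, so PQ + QP = 0. Multiplying by P on either
side gives PQ = -PQP = QP, whence 2PQ = 0. -/
theorem proj_mul_of_disjoint {S T : Set ℝ} (hS : MeasurableSet S) (hT : MeasurableSet T)
    (hd : Disjoint S T) : E.proj S * E.proj T = 0 := by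
  have hP := (E.isStarProjection S hS).isIdempotentElem.eq
  have hQ := (E.isStarProjection T hT).isIdempotentElem.eq
  have hPQ := (E.isStarProjection _ (hS.union hT)).isIdempotentElem.eq
  rw [E.proj_union hS hT hd] at hPQ
  set P := E.proj S
  set Q := E.proj T
  have h0 : P * Q + Q * P = 0 := by
    have : (P + Q) * (P + Q) = P * P + Q * Q + (P * Q + Q * P) := by noncomm_ring
    rw [this, hP, hQ] at hPQ
    simpa using hPQ
  have h1 : P * Q + P * Q * P = 0 := by
    have : P * (P * Q + Q * P) = P * P * Q + P * Q * P := by noncomm_ring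
    rw [h0, hP, mul_zero] at this
    exact this.symm
  have h2 : P * Q * P + Q * P = 0 := by
    have : (P * Q + Q * P) * P = P * Q * P + Q * (P * P) := by noncomm_ring
    rw [h0, hP, zero_mul] at this
    exact this.symm
  have h3 : P * Q = Q * P := by
    rw [eq_neg_of_add_eq_zero_left h1, eq_neg_of_add_eq_zero_right h2]
  have h4 : (2 : ℂ) • (P * Q) = 0 := by
    rw [two_smul]
    nth_rewrite 2 [h3]
    exact h0
  simpa using h4

theorem inner_proj_of_disjoint {S T : Set ℝ} (hS : MeasurableSet S) (hT : MeasurableSet T)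
    (hd : Disjoint S T) (φ : H) : ⟪E.proj S φ, E.proj T φ⟫_ℂ = 0 := by
  have h2 : ContinuousLinearMap.adjoint (E.proj S) = E.proj S :=
    (E.isStarProjection S hS).isSelfAdjoint
  rw [← h2, ContinuousLinearMap.adjoint_inner_left, ← mul_apply_eq_comp,
    E.proj_mul_of_disjoint hS hT hd]
  simp

theorem scalar_apply_eq_enorm (φ : H) {S : Set ℝ} (hS : MeasurableSet S) :
    E.scalar φ S = ‖E.proj S φ‖ₑ ^ 2 := by
  rw [E.scalar_apply φ hS, E.inner_proj hS, ENNReal.ofReal_pow (norm_nonneg _), ofReal_norm]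

instance (φ : H) : IsFiniteMeasure (E.scalar φ) :=
  ⟨by rw [E.scalar_apply_eq_enorm φ MeasurableSet.univ]; finiteness⟩

/-- The operator `∑ c E(s⁻¹{c})` of a simple function `s`. -/
def simpleOp : SimpleFunc ℝ ℂ →ₗ[ℂ] H →L[ℂ] H :=
  let T : Set ℝ → ℂ →L[ℝ] (H →L[ℂ] H) := fun S =>
    (ContinuousLinearMap.toSpanSingleton ℂ (E.proj S)).restrictScalars ℝ
  -- With the zero measure every set has finite measure, so no finiteness restriction remains.
  have hT : FinMeasAdditive (0 : Measure ℝ) T := fun S S' hS hS' _ _ hd => by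
    ext c : 1
    simp [T, E.proj_union hS hS' hd]
  { toFun := SimpleFunc.setToSimpleFunc T
    map_add' := fun f g => SimpleFunc.setToSimpleFunc_add T hT (μ := 0) (by simp) (by simp)
    map_smul' := fun c f => SimpleFunc.setToSimpleFunc_smul T hT
      (fun c s x => by simp [T, mul_smul]) c (by simp) }

theorem simpleOp_apply (s : SimpleFunc ℝ ℂ) (φ : H) :
    E.simpleOp s φ = ∑ c ∈ s.range, c • E.proj (s ⁻¹' {c}) φ := by
  change (∑ c ∈ s.range, c • E.proj (s ⁻¹' {c})) φ = _
  simp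

/-- Pythagoras: the fibres of s are disjoint, so the vectors E(s⁻¹{c}) φ are orthogonal. -/
theorem enorm_simpleOp_sq (s : SimpleFunc ℝ ℂ) (φ : H) :
    ‖E.simpleOp s φ‖ₑ ^ 2 = ∫⁻ x, ‖s x‖ₑ ^ 2 ∂(E.scalar φ) := by
  have h1 : ∫⁻ x, ‖s x‖ₑ ^ 2 ∂(E.scalar φ) =
      ∑ c ∈ s.range, ‖c‖ₑ ^ 2 * E.scalar φ (s ⁻¹' {c}) := by
    rw [← SimpleFunc.map_lintegral (fun c : ℂ => ‖c‖ₑ ^ 2) s, ← SimpleFunc.lintegral_eq_lintegral]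
    rfl
  have h2 : ‖E.simpleOp s φ‖ ^ 2 = ∑ c ∈ s.range, ‖c‖ ^ 2 * ‖E.proj (s ⁻¹' {c}) φ‖ ^ 2 := by
    have : ((‖E.simpleOp s φ‖ ^ 2 : ℝ) : ℂ) =
        ((∑ c ∈ s.range, ‖c‖ ^ 2 * ‖E.proj (s ⁻¹' {c}) φ‖ ^ 2 : ℝ) : ℂ) := by
      have := inner_self_eq_norm_sq_to_K (𝕜 := ℂ) (E.simpleOp s φ)
      push_cast
      rw [← Complex.coe_algebraMap, ← this, simpleOp_apply, sum_inner]
      refine Finset.sum_congr rfl fun c hc => ?_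
      rw [inner_sum, Finset.sum_eq_single c]
      · rw [inner_self_eq_norm_sq_to_K, norm_smul]
        push_cast
        ring
      · intro d _ hdc
        rw [inner_smul_left, inner_smul_right, E.inner_proj_of_disjoint
          (s.measurableSet_preimage _) (s.measurableSet_preimage _)]
        · simp
        · exact Disjoint.preimage _ (by simpa using hdc.symm)
      · intro h
        exact absurd hc h
    exact_mod_cast this
  rw [h1, ← ofReal_norm, ← ENNReal.ofReal_pow (norm_nonneg _), h2,
    ENNReal.ofReal_sum_of_nonneg fun c _ => by positivity]
  refine Finset.sum_congr rfl fun c _ => ?_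
  rw [E.scalar_apply_eq_enorm φ (s.measurableSet_preimage _), ENNReal.ofReal_mul (by positivity),
    ENNReal.ofReal_pow (norm_nonneg _), ENNReal.ofReal_pow (norm_nonneg _), ofReal_norm,
    ofReal_norm]

/-- The coercion of simple functions to functions, as a linear map. -/
def simpleCoe : SimpleFunc ℝ ℂ →ₗ[ℂ] ℝ → ℂ where
  toFun s := s
  map_add' _ _ := rfl
  map_smul' _ _ := rfl

theorem isBddMeas_simpleFunc (s : SimpleFunc ℝ ℂ) : IsBddMeas (s : ℝ → ℂ) :=
  ⟨s.measurable, s.exists_forall_norm_le⟩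

end ProjMeasure

theorem integral_indicator_one_complex {X : Type*} [MeasurableSpace X] {ν : Measure X} {S : Set X}
    (hS : MeasurableSet S) : ∫ x, S.indicator (1 : X → ℂ) x ∂ν = (ν.real S : ℂ) := by
  rw [MeasureTheory.integral_indicator hS]
  simp

theorem enorm_eq_eLpNorm_two {X F : Type*} [MeasurableSpace X] [NormedAddCommGroup F] {ν : Measure X}
    {f : X → F} {ψ : H} (h : ‖ψ‖ₑ ^ 2 = ∫⁻ x, ‖f x‖ₑ ^ 2 ∂ν) : ‖ψ‖ₑ = eLpNorm f 2 ν := by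
  rw [eLpNorm_eq_lintegral_rpow_enorm_toReal (by norm_num) (by norm_num)]
  simp only [ENNReal.toReal_ofNat, ENNReal.rpow_ofNat]
  rw [← h, ← ENNReal.rpow_natCast, ← ENNReal.rpow_mul]
  norm_num

namespace ProjMeasure

variable (E : ProjMeasure H)

theorem isCalculus : IsCalculus E.scalar simpleCoe E.simpleOp where
  finite φ := inferInstance
  memLp s φ := (isBddMeas_simpleFunc s).memLp _ _
  dense ν _ f hf ε hε := by
    obtain ⟨g, hg, -⟩ := hf.exists_simpleFunc_eLpNorm_sub_lt (by norm_num) hε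
    exact ⟨g, hg.le⟩
  enorm_apply s φ := enorm_eq_eLpNorm_two (E.enorm_simpleOp_sq s φ)
  exists_one := ⟨SimpleFunc.const ℝ 1, rfl, by
    ext φ
    rw [simpleOp_apply]
    have : (1 : ℝ → ℂ) ⁻¹' {1} = Set.univ := by ext; simp
    simp [this, E.univ]⟩

/-- `∫ f(λ) dE_λ` for bounded measurable `f`. -/
def integral (f : ℝ → ℂ) : H →L[ℂ] H := op E.scalar simpleCoe E.simpleOp f

theorem integral_indicator {S : Set ℝ} (hS : MeasurableSet S) :
    E.integral (S.indicator 1) = E.proj S := by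
  refine op_eq_of_inner E.isCalculus (isBddMeas_indicator hS) fun φ => ?_
  have h : E.proj S (E.proj S φ) = E.proj S φ :=
    congrArg (fun T : H →L[ℂ] H => T φ) (E.isStarProjection S hS).isIdempotentElem
  have h2 : ContinuousLinearMap.adjoint (E.proj S) = E.proj S :=
    (E.isStarProjection S hS).isSelfAdjoint
  have h3 : ⟪φ, E.proj S φ⟫_ℂ = ⟪E.proj S φ, E.proj S φ⟫_ℂ := by
    conv_lhs => rw [← h, ← ContinuousLinearMap.adjoint_inner_left, h2]
  rw [integral_indicator_one_complex hS, Measure.real, E.scalar_apply_eq_enorm φ hS, h3,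
    inner_self_eq_norm_sq_to_K]
  simp

theorem proj_inter {S T : Set ℝ} (hS : MeasurableSet S) (hT : MeasurableSet T) :
    E.proj (S ∩ T) = E.proj S * E.proj T := by
  rw [← E.integral_indicator hS, ← E.integral_indicator hT,
    ← E.integral_indicator (hS.inter hT), integral, integral, integral,
    ← op_mul E.isCalculus (isBddMeas_indicator hS) (isBddMeas_indicator hT)]
  congr 1
  ext x
  by_cases h₁ : x ∈ S <;> by_cases h₂ : x ∈ T <;> simp [h₁, h₂]

theorem scalar_proj {S : Set ℝ} (hS : MeasurableSet S) (φ : H) :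
    E.scalar (E.proj S φ) = (E.scalar φ).restrict S := by
  ext T hT
  rw [Measure.restrict_apply hT, E.scalar_apply_eq_enorm _ hT,
    E.scalar_apply_eq_enorm _ (hT.inter hS), E.proj_inter hT hS]
  rfl

end ProjMeasure

/-! ### Unitary groups -/

theorem isFormalAdjoint_self {B : H →ₗ.[ℂ] H} (hB : IsSelfAdjoint B) (φ ψ : B.domain) :
    ⟪B φ, (ψ : H)⟫_ℂ = ⟪(φ : H), B ψ⟫_ℂ := by
  have h := B.adjoint_isFormalAdjoint hB.dense_domain
  rw [LinearPMap.isSelfAdjoint_def.1 hB] at h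
  exact h φ ψ

namespace IsUnitaryGroupOf

variable {B : H →ₗ.[ℂ] H} {U V : ℝ → H →L[ℂ] H}

theorem norm_apply (h : IsUnitaryGroupOf B U) (t : ℝ) (φ : H) : ‖U t φ‖ = ‖φ‖ :=
  ContinuousLinearMap.norm_map_of_mem_unitary (h.mem_unitary t) φ

theorem apply_add (h : IsUnitaryGroupOf B U) (s t : ℝ) (φ : H) : U (s + t) φ = U s (U t φ) := by
  rw [h.map_add]; rfl

theorem adjoint_eq (h : IsUnitaryGroupOf B U) (t : ℝ) :
    ContinuousLinearMap.adjoint (U t) = U (-t) := by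
  have h1 : ContinuousLinearMap.adjoint (U t) * U t = 1 :=
    (Unitary.mem_iff.1 (h.mem_unitary t)).1
  have h2 : U t * U (-t) = 1 := by rw [← h.map_add, add_neg_cancel, h.map_zero]
  calc _ = ContinuousLinearMap.adjoint (U t) * (U t * U (-t)) := by rw [h2, mul_one]
    _ = U (-t) := by rw [← mul_assoc, h1, one_mul]

theorem inner_apply_left (h : IsUnitaryGroupOf B U) (t : ℝ) (φ ψ : H) :
    ⟪U t φ, ψ⟫_ℂ = ⟪φ, U (-t) ψ⟫_ℂ := by
  rw [← h.adjoint_eq, ContinuousLinearMap.adjoint_inner_right]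

theorem inner_map_map (h : IsUnitaryGroupOf B U) (t : ℝ) (φ ψ : H) :
    ⟪U t φ, U t ψ⟫_ℂ = ⟪φ, ψ⟫_ℂ := by
  rw [h.inner_apply_left, ← h.apply_add, neg_add_cancel, h.map_zero]; rfl

theorem hasDerivAt_zero (h : IsUnitaryGroupOf B U) (φ : B.domain) :
    HasDerivAt (fun t => U t φ) (Complex.I • B φ) 0 :=
  (h.generator _ _).1 (B.mem_graph φ)

theorem apply_mem_graph (h : IsUnitaryGroupOf B U) (φ : B.domain) (s : ℝ) :
    (U s φ, U s (B φ)) ∈ B.graph := by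
  rw [h.generator]
  have h1 := ((U s).restrictScalars ℝ).hasFDerivAt.comp_hasDerivAt (0 : ℝ) (h.hasDerivAt_zero φ)
  have h2 : (fun t => U t (U s φ)) = ((U s).restrictScalars ℝ) ∘ fun t => U t φ := by
    ext t
    change _ = U s (U t φ)
    rw [← h.apply_add, ← h.apply_add, add_comm]
  rw [h2, ← map_smul]
  exact h1

theorem hasDerivAt (h : IsUnitaryGroupOf B U) (φ : B.domain) (s : ℝ) :
    HasDerivAt (fun t => U t φ) (Complex.I • U s (B φ)) s := by
  have h0 : HasDerivAt (fun t => U t φ) (Complex.I • B φ) (s - s) := by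
    rw [sub_self]; exact h.hasDerivAt_zero φ
  have h1 := ((U s).restrictScalars ℝ).hasFDerivAt.comp_hasDerivAt s
    (h0.comp_sub_const s s)
  have h2 : (fun t => U t φ) = ((U s).restrictScalars ℝ) ∘ fun t => U (t - s) φ := by
    ext t
    change _ = U s (U (t - s) φ)
    rw [← h.apply_add, add_sub_cancel]
  rw [h2, ← map_smul]
  exact h1

/-- On the domain, ⟨U(s)φ, V(s)φ⟩ has derivative 0 because B is symmetric, so it stays equal to
‖φ‖²; expanding ‖U(t)φ - V(t)φ‖² then gives 0. Density finishes. -/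
theorem unique (hB : IsSelfAdjoint B) (hU : IsUnitaryGroupOf B U) (hV : IsUnitaryGroupOf B V) :
    U = V := by
  have key : ∀ (φ : B.domain) t, U t φ = V t φ := by
    intro φ t
    have hd : ∀ s, HasDerivAt (fun s => ⟪U s φ, V s φ⟫_ℂ) 0 s := by
      intro s
      have h1 := (hU.hasDerivAt φ s).inner ℂ (hV.hasDerivAt φ s)
      refine h1.congr_deriv ?_
      obtain ⟨u, hu, hu'⟩ := (LinearPMap.mem_graph_iff _).1 (hU.apply_mem_graph φ s)
      obtain ⟨v, hv, hv'⟩ := (LinearPMap.mem_graph_iff _).1 (hV.apply_mem_graph φ s)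
      simp only at hu hu' hv hv'
      rw [← hu', ← hv', ← hu, ← hv, inner_smul_left, inner_smul_right,
        isFormalAdjoint_self hB u v]
      simp
    have hc : ⟪U t φ, V t φ⟫_ℂ = ⟪U 0 φ, V 0 φ⟫_ℂ :=
      is_const_of_deriv_eq_zero (fun s => (hd s).differentiableAt) (fun s => (hd s).deriv) t 0
    rw [hU.map_zero, hV.map_zero] at hc
    have : ‖U t φ - V t φ‖ ^ 2 = 0 := by
      rw [norm_sub_sq (𝕜 := ℂ), hc, hU.norm_apply, hV.norm_apply]
      simp only [one_apply_eq_self]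
      rw [inner_self_eq_norm_sq]
      ring
    rw [← sub_eq_zero, ← norm_eq_zero]
    exact pow_eq_zero_iff (two_ne_zero) |>.1 this
  ext t φ
  have := Continuous.ext_on hB.dense_domain (U t).continuous (V t).continuous
    (fun φ hφ => key ⟨φ, hφ⟩ t)
  exact congrFun this φ

end IsUnitaryGroupOf

theorem isUnitaryGroupOf_expI {B : H →ₗ.[ℂ] H} {U : ℝ → H →L[ℂ] H} (h : IsUnitaryGroupOf B U) :
    IsUnitaryGroupOf B (expI B) := by
  have h' : ∃ U : ℝ → H →L[ℂ] H, IsUnitaryGroupOf B U := ⟨U, h⟩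
  have : expI B = h'.choose := by
    ext1 t
    rw [expI, dif_pos h']
  rw [this]
  exact h'.choose_spec

/-! ### The unitary group of a spectral measure -/

/-- The character `x ↦ e^{itx}`. -/
def character (t x : ℝ) : ℂ := Complex.exp ((t * x : ℝ) * Complex.I)

theorem norm_character (t x : ℝ) : ‖character t x‖ = 1 := Complex.norm_exp_ofReal_mul_I _

theorem isBddMeas_character (t : ℝ) : IsBddMeas (character t) := by
  refine ⟨?_, 1, fun x => (norm_character t x).le⟩
  unfold character
  fun_prop

theorem character_add (s t : ℝ) : character (s + t) = character s * character t := by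
  ext x
  simp only [character, Pi.mul_apply, ← Complex.exp_add]
  congr 1
  push_cast
  ring

theorem character_zero : character 0 = 1 := by
  ext x
  simp [character]

theorem conj_character (t x : ℝ) : (starRingEnd ℂ) (character t x) = character (-t) x := by
  simp only [character, ← Complex.exp_conj, map_mul, Complex.conj_I, Complex.conj_ofReal]
  congr 1
  push_cast
  ring

theorem norm_character_sub_one_le (t x : ℝ) : ‖character t x - 1‖ ≤ |t| * |x| := by
  have := Real.norm_exp_I_mul_ofReal_sub_one_le (x := t * x)
  rwa [mul_comm, norm_mul, Real.norm_eq_abs, Real.norm_eq_abs] at this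

theorem hasDerivAt_character (x : ℝ) :
    HasDerivAt (fun t => character t x) (Complex.I * x) 0 := by
  have h1 : HasDerivAt (fun t : ℝ => ((t * x : ℝ) : ℂ) * Complex.I) (x * Complex.I) 0 := by
    have := ((hasDerivAt_id (0 : ℝ)).mul_const x).ofReal_comp.mul_const Complex.I
    simpa using this
  have := h1.cexp
  simpa [character, mul_comm] using this

namespace ProjMeasure

variable (E : ProjMeasure H)

theorem norm_integral_sub_sq {f g : ℝ → ℂ} (hf : IsBddMeas f) (hg : IsBddMeas g) (φ : H) :
    ‖E.integral f φ - E.integral g φ‖ ^ 2 = ∫ x, ‖f x - g x‖ ^ 2 ∂(E.scalar φ) :=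
  ((rep_op E.isCalculus hf φ).sub E.isCalculus (rep_op E.isCalculus hg φ)).norm_sq_eq E.isCalculus

theorem integral_character_add (s t : ℝ) : E.integral (character (s + t)) =
    E.integral (character s) * E.integral (character t) := by
  rw [character_add]
  exact op_mul E.isCalculus (isBddMeas_character s) (isBddMeas_character t)

theorem integral_character_zero : E.integral (character 0) = 1 := by
  rw [character_zero]
  exact op_one E.isCalculus

theorem integral_character_mem_unitary (t : ℝ) :
    E.integral (character t) ∈ unitary (H →L[ℂ] H) := by
  have h : star (E.integral (character t)) = E.integral (character (-t)) := by
    have := op_star E.isCalculus (isBddMeas_character t)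
    simp only [conj_character] at this
    exact this.symm
  rw [Unitary.mem_iff, h, ← integral_character_add, ← integral_character_add]
  simp [integral_character_zero]

theorem continuous_integral_character (φ : H) :
    Continuous fun t => E.integral (character t) φ := by
  rw [continuous_iff_continuousAt]
  intro s
  rw [ContinuousAt, tendsto_iff_norm_sub_tendsto_zero]
  have h : Tendsto (fun t => ‖E.integral (character t) φ - E.integral (character s) φ‖ ^ 2)
      (𝓝 s) (𝓝 0) := by
    simp only [E.norm_integral_sub_sq (isBddMeas_character _) (isBddMeas_character s)]
    rw [← integral_zero ℝ ℝ (μ := E.scalar φ)]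
    refine tendsto_integral_filter_of_dominated_convergence (fun _ => (4 : ℝ)) ?_ ?_
      (integrable_const _) ?_
    · exact Eventually.of_forall fun t => ((((isBddMeas_character t).1.sub
        (isBddMeas_character s).1).norm).pow_const 2).aestronglyMeasurable
    · refine Eventually.of_forall fun t => ae_of_all _ fun x => ?_
      rw [Real.norm_of_nonneg (by positivity)]
      have : ‖character t x - character s x‖ ≤ 2 := by
        refine (norm_sub_le _ _).trans ?_
        rw [norm_character, norm_character]; norm_num
      nlinarith [norm_nonneg (character t x - character s x)]
    · refine ae_of_all _ fun x => ?_
      have hc : Continuous fun t => ‖character t x - character s x‖ ^ 2 := by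
        unfold character
        fun_prop
      simpa using hc.tendsto s
  have := h.sqrt
  simpa using this

theorem memLp_id {φ : H} (h : ∫⁻ x, ENNReal.ofReal (x ^ 2) ∂(E.scalar φ) < ∞) :
    MemLp (fun x : ℝ => Complex.I * x) 2 (E.scalar φ) := by
  have hm : AEStronglyMeasurable (fun x : ℝ => Complex.I * x) (E.scalar φ) := by fun_prop
  rw [memLp_two_iff_integrable_sq_norm hm]
  refine ⟨by fun_prop, ?_⟩
  rw [HasFiniteIntegral]
  convert h using 2
  ext x
  rw [Real.enorm_of_nonneg (by positivity)]
  simp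

/-- Dominated convergence: |(e^{itx} - 1)/t - ix|² is at most 4x², which is integrable because ix is
in L². -/
theorem hasDerivAt_of_rep {φ ψ : H}
    (hr : Rep E.scalar simpleCoe E.simpleOp φ (fun x : ℝ => Complex.I * x) ψ) :
    HasDerivAt (fun t => E.integral (character t) φ) ψ 0 := by
  rw [hasDerivAt_iff_tendsto_slope_zero, tendsto_iff_norm_sub_tendsto_zero]
  have hs : ∀ t : ℝ, Rep E.scalar simpleCoe E.simpleOp φ
      ((((t⁻¹ : ℝ) : ℂ) • (character t - character 0)) - fun x : ℝ => Complex.I * x)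
      (t⁻¹ • (E.integral (character (0 + t)) φ - E.integral (character 0) φ) - ψ) := by
    intro t
    have := ((((rep_op E.isCalculus (isBddMeas_character t) φ).sub E.isCalculus
      (rep_op E.isCalculus (isBddMeas_character 0) φ)).smul ((t⁻¹ : ℝ) : ℂ))).sub E.isCalculus hr
    rw [zero_add, ← Complex.coe_smul]
    exact this
  have hx2 : Integrable (fun x : ℝ => 4 * x ^ 2) (E.scalar φ) := by
    have := ((memLp_two_iff_integrable_sq_norm hr.1.1).1 hr.1).const_mul 4
    simpa using this
  have h : Tendsto (fun t : ℝ => ‖t⁻¹ • (E.integral (character (0 + t)) φ -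
      E.integral (character 0) φ) - ψ‖ ^ 2) (𝓝[≠] 0) (𝓝 0) := by
    simp only [fun t => (hs t).norm_sq_eq E.isCalculus]
    have h00 : (0 : ℝ) = ∫ _x, (0 : ℝ) ∂(E.scalar φ) := by simp
    conv in 𝓝 (0 : ℝ) => rw [h00]
    refine tendsto_integral_filter_of_dominated_convergence (fun x => 4 * x ^ 2) ?_ ?_ hx2 ?_
    · refine Eventually.of_forall fun t => ?_
      exact (((hs t).1.1.norm).pow 2)
    · filter_upwards [self_mem_nhdsWithin] with t ht
      refine ae_of_all _ fun x => ?_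
      rw [Real.norm_of_nonneg (by positivity)]
      have h1 : ‖((((t⁻¹ : ℝ) : ℂ) • (character t - character 0)) -
          fun x : ℝ => Complex.I * x) x‖ ≤ 2 * |x| := by
        simp only [character_zero, Pi.sub_apply, Pi.smul_apply, Pi.one_apply, smul_eq_mul]
        refine (norm_sub_le _ _).trans ?_
        rw [norm_mul]
        have h2 := norm_character_sub_one_le t x
        have h3 : |t|⁻¹ * ‖character t x - 1‖ ≤ |x| := by
          rw [inv_mul_le_iff₀ (abs_pos.2 ht)]
          exact h2
        simp only [Complex.norm_real, norm_inv, Real.norm_eq_abs, norm_mul, Complex.norm_I,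
          one_mul]
        linarith
      calc _ ≤ (2 * |x|) ^ 2 := pow_le_pow_left₀ (norm_nonneg _) h1 2
        _ = 4 * x ^ 2 := by rw [mul_pow, sq_abs]; norm_num
    · refine ae_of_all _ fun x => ?_
      have h1 := (hasDerivAt_iff_tendsto_slope_zero.1 (hasDerivAt_character x))
      have h2 := ((h1.sub_const (Complex.I * x)).norm).pow 2
      simpa [← Complex.coe_smul] using h2
  have := h.sqrt
  simpa using this

/-- The converse direction, by Fatou: the difference quotients converge in H, so their norms, the L²
norms of (e^{itx} - 1)/t, stay bounded, while these functions tend to ix pointwise. -/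
theorem lintegral_sq_lt_top_of_hasDerivAt {φ ψ : H}
    (h : HasDerivAt (fun t => E.integral (character t) φ) ψ 0) :
    ∫⁻ x, ENNReal.ofReal (x ^ 2) ∂(E.scalar φ) < ∞ := by
  have hseq : Tendsto (fun n : ℕ => ((n : ℝ) + 1)⁻¹) atTop (𝓝[≠] 0) := by
    rw [tendsto_nhdsWithin_iff]
    refine ⟨?_, Eventually.of_forall fun n => ?_⟩
    · simpa using tendsto_one_div_add_atTop_nhds_zero_nat (𝕜 := ℝ)
    · simp only [mem_compl_iff, mem_singleton_iff, inv_eq_zero]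
      positivity
  let F : ℕ → ℝ → ℂ := fun n =>
    (((((n : ℝ) + 1)⁻¹)⁻¹ : ℝ) : ℂ) • (character (((n : ℝ) + 1)⁻¹) - character 0)
  have hF : ∀ n, Rep E.scalar simpleCoe E.simpleOp φ (F n) ((((n : ℝ) + 1)⁻¹)⁻¹ •
      (E.integral (character (0 + ((n : ℝ) + 1)⁻¹)) φ - E.integral (character 0) φ)) := by
    intro n
    have := (((rep_op E.isCalculus (isBddMeas_character (((n : ℝ) + 1)⁻¹)) φ).sub E.isCalculus
      (rep_op E.isCalculus (isBddMeas_character 0) φ)).smul (((((n : ℝ) + 1)⁻¹)⁻¹ : ℝ) : ℂ))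
    rw [zero_add, ← Complex.coe_smul]
    exact this
  have h1 := ENNReal.Tendsto.pow (n := 2) ((hasDerivAt_iff_tendsto_slope_zero.1 h).comp hseq).enorm
  have h2 : ∀ n : ℕ, ‖(((n : ℝ) + 1)⁻¹)⁻¹ • (E.integral (character (0 + ((n : ℝ) + 1)⁻¹)) φ -
      E.integral (character 0) φ)‖ₑ ^ 2 = ∫⁻ x, ‖F n x‖ₑ ^ 2 ∂(E.scalar φ) := by
    intro n
    rw [(hF n).enorm_eq E.isCalculus,
      eLpNorm_eq_lintegral_rpow_enorm_toReal (by norm_num) (by norm_num)]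
    simp only [ENNReal.toReal_ofNat, ENNReal.rpow_ofNat]
    rw [← ENNReal.rpow_natCast, ← ENNReal.rpow_mul]
    norm_num
  have h3 : ∀ x : ℝ, ENNReal.ofReal (x ^ 2) = liminf (fun n => ‖F n x‖ₑ ^ 2) atTop := by
    intro x
    have h4 := ENNReal.Tendsto.pow (n := 2)
      ((hasDerivAt_iff_tendsto_slope_zero.1 (hasDerivAt_character x)).comp hseq).enorm
    have h5 : ‖Complex.I * (x : ℂ)‖ₑ ^ 2 = ENNReal.ofReal (x ^ 2) := by
      rw [← ofReal_norm, ← ENNReal.ofReal_pow (norm_nonneg _)]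
      simp
    rw [h5] at h4
    rw [← h4.liminf_eq]
    congr 1
    ext n
    simp only [F, Function.comp, zero_add, Pi.smul_apply, Pi.sub_apply, smul_eq_mul]
    rw [← Complex.coe_smul, smul_eq_mul]
  simp only [h3]
  refine (lintegral_liminf_le fun n => ?_).trans_lt ?_
  · exact (((((isBddMeas_character _).1.sub (isBddMeas_character 0).1).const_smul
      _).enorm).pow_const 2)
  · simp only [← h2]
    refine (Tendsto.liminf_eq h1).trans_lt ?_
    finiteness

end ProjMeasure

theorem inner_eq_of_inner_self_eq {K : Submodule ℂ H} (S T : K →ₗ[ℂ] H)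
    (h : ∀ φ : K, ⟪(φ : H), S φ⟫_ℂ = ⟪(φ : H), T φ⟫_ℂ) (φ ψ : K) :
    ⟪(φ : H), S ψ⟫_ℂ = ⟪(φ : H), T ψ⟫_ℂ := by
  have h0 : ∀ φ : K, ⟪(φ : H), (S - T) φ⟫_ℂ = 0 := fun φ => by
    rw [LinearMap.sub_apply, inner_sub_right, h, sub_self]
  have h1 := h0 (φ + ψ)
  have h2 := h0 (φ + Complex.I • ψ)
  simp only [map_add, map_smul, Submodule.coe_add, Submodule.coe_smul, inner_add_left,
    inner_add_right, inner_smul_left, inner_smul_right, h0, Complex.conj_I] at h1 h2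
  rw [← sub_eq_zero, ← inner_sub_right, ← LinearMap.sub_apply]
  have h3 : Complex.I * ((⟪(φ : H), (S - T) ψ⟫_ℂ) - ⟪(ψ : H), (S - T) φ⟫_ℂ) = 0 := by
    linear_combination h2
  have h4 := (mul_eq_zero.1 h3).resolve_left Complex.I_ne_zero
  linear_combination (h1 + h4) / 2

/-- The derivative at 0 of the group on the domain is the vector L φ represented by ix. It has the
same quadratic form as iB, so polarization on the domain and density give L = iB. Fatou shows that
differentiability forces membership in the domain. -/
theorem IsSpectralMeasureOf.isUnitaryGroupOf {B : H →ₗ.[ℂ] H} (hB : IsSelfAdjoint B)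
    {E : ProjMeasure H} (h : IsSpectralMeasureOf B E) :
    IsUnitaryGroupOf B fun t => E.integral (character t) := by
  have hex : ∀ φ : B.domain, ∃ ψ, Rep E.scalar ProjMeasure.simpleCoe E.simpleOp (φ : H)
      (fun x : ℝ => Complex.I * x) ψ := fun φ =>
    Rep.exists E.isCalculus _ (E.memLp_id ((h.mem_domain_iff φ).1 φ.2))
  choose L hL using hex
  have hd : ∀ φ : B.domain, HasDerivAt (fun t => E.integral (character t) φ) (L φ) 0 := fun φ =>
    E.hasDerivAt_of_rep (hL φ)
  -- Linearity of L is read off from uniqueness of derivatives.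
  let S : B.domain →ₗ[ℂ] H :=
    { toFun := L
      map_add' := fun φ ψ => by
        refine (hd (φ + ψ)).unique ?_
        simp only [Submodule.coe_add, _root_.map_add]
        exact (hd φ).add (hd ψ)
      map_smul' := fun c φ => by
        refine (hd (c • φ)).unique ?_
        simp only [Submodule.coe_smul, map_smul]
        exact (hd φ).const_smul c }
  have hS : ∀ φ : B.domain, ⟪(φ : H), S φ⟫_ℂ = ⟪(φ : H), (Complex.I • B.toFun) φ⟫_ℂ := by
    intro φ
    change ⟪(φ : H), L φ⟫_ℂ = ⟪(φ : H), Complex.I • B φ⟫_ℂ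
    rw [inner_smul_right, h.inner_apply, (hL φ).inner_left_eq E.isCalculus,
      MeasureTheory.integral_const_mul, integral_complex_ofReal]
  have hLB : ∀ φ : B.domain, L φ = Complex.I • B φ := by
    intro φ
    refine hB.dense_domain.eq_of_inner_right (𝕜 := ℂ) fun v => ?_
    intro hv
    exact inner_eq_of_inner_self_eq S (Complex.I • B.toFun) hS ⟨v, hv⟩ φ
  refine ⟨E.integral_character_mem_unitary, E.integral_character_zero, E.integral_character_add,
    E.continuous_integral_character, fun φ ψ => ?_⟩
  constructor
  · intro hg
    obtain ⟨u, hu, hu'⟩ := (LinearPMap.mem_graph_iff _).1 hg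
    simp only at hu hu'
    rw [← hu, ← hu', ← hLB]
    exact hd u
  · intro hder
    have hφ : φ ∈ B.domain := (h.mem_domain_iff φ).2 (E.lintegral_sq_lt_top_of_hasDerivAt hder)
    refine (LinearPMap.mem_graph_iff _).2 ⟨⟨φ, hφ⟩, rfl, ?_⟩
    have := (hd ⟨φ, hφ⟩).unique hder
    rw [hLB] at this
    exact smul_right_injective H Complex.I_ne_zero this

theorem IsSpectralMeasureOf.expI_eq {B : H →ₗ.[ℂ] H} (hB : IsSelfAdjoint B)
    {E : ProjMeasure H} (h : IsSpectralMeasureOf B E) (t : ℝ) :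
    expI B t = E.integral (character t) :=
  congrFun (IsUnitaryGroupOf.unique hB (isUnitaryGroupOf_expI (h.isUnitaryGroupOf hB))
    (h.isUnitaryGroupOf hB)) t

theorem IsSpectralMeasureOf.inner_expI {B : H →ₗ.[ℂ] H} (hB : IsSelfAdjoint B)
    {E : ProjMeasure H} (h : IsSpectralMeasureOf B E) (t : ℝ) (φ : H) :
    ⟪φ, expI B t φ⟫_ℂ = ∫ x, character t x ∂(E.scalar φ) := by
  rw [h.expI_eq hB]
  exact inner_op E.isCalculus (isBddMeas_character t) φ

/-! ### The spectral theorem -/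

section Mul

variable {X D : Type*} [MeasurableSpace X] [AddCommGroup D] [Module ℂ D]
variable {μ : H → Measure X} {j : D →ₗ[ℂ] X → ℂ} {π : D →ₗ[ℂ] H →L[ℂ] H}

/-- Lets a bounded g act on a vector represented by an unbounded f; below it applies the resolvent
to the vector (λ + i)φ. -/
theorem Rep.mul (h : IsCalculus μ j π) (hj : ∀ d, IsBddMeas (j d)) {φ ψ : H} {f g : X → ℂ}
    (hr : Rep μ j π φ f ψ) (hg : IsBddMeas g) : Rep μ j π φ (g * f) (op μ j π g ψ) := by
  obtain ⟨c, hc⟩ := hg.2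
  have hgf : MemLp (g * f) 2 (μ φ) := by
    refine MemLp.of_le_mul (c := c) hr.1 (hg.1.aestronglyMeasurable.mul hr.1.1)
      (ae_of_all _ fun x => ?_)
    rw [Pi.mul_apply, norm_mul]
    exact mul_le_mul_of_nonneg_right (hc x) (norm_nonneg _)
  obtain ⟨χ, hχ⟩ := Rep.exists h φ hgf
  obtain ⟨hf, d, hd, hd'⟩ := hr
  have h1 : Tendsto (fun n => op μ j π g (π (d n) φ)) atTop (𝓝 (op μ j π g ψ)) :=
    ((op μ j π g).continuous.tendsto ψ).comp hd'
  have h2 : ∀ n, op μ j π g (π (d n) φ) = op μ j π (g * j (d n)) φ := by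
    intro n
    rw [op_mul h hg (hj _), op_coe h _ (hj _)]
    rfl
  have h3 : Tendsto (fun n => op μ j π g (π (d n) φ)) atTop (𝓝 χ) := by
    have h0 : Tendsto (fun n => op μ j π g (π (d n) φ) - χ) atTop (𝓝 0) := by
      rw [tendsto_zero_iff_enorm_tendsto_zero]
      refine tendsto_zero_of_le (v := fun n => ENNReal.ofReal c * eLpNorm (f - j (d n)) 2 (μ φ))
        (by simpa using ENNReal.Tendsto.const_mul hd (Or.inr ENNReal.ofReal_ne_top)) fun n => ?_
      rw [h2, ((rep_op h (hg.mul (hj (d n))) φ).sub h hχ).enorm_eq h]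
      refine eLpNorm_le_mul_eLpNorm_of_ae_le_mul (ae_of_all _ fun x => ?_) 2
      have : (g * j (d n) - g * f) x = - (g x * (f x - j (d n) x)) := by
        simp only [Pi.sub_apply, Pi.mul_apply]; ring
      rw [this, norm_neg, norm_mul]
      exact mul_le_mul_of_nonneg_right (hc x) (norm_nonneg _)
    simpa using h0.add_const χ
  rw [tendsto_nhds_unique h1 h3]
  exact hχ

theorem enorm_op_sq (h : IsCalculus μ j π) {f : X → ℂ} (hf : IsBddMeas f) (φ : H) :
    ‖op μ j π f φ‖ₑ ^ 2 = ∫⁻ x, ‖f x‖ₑ ^ 2 ∂(μ φ) := by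
  rw [(rep_op h hf φ).enorm_eq h,
    eLpNorm_eq_lintegral_rpow_enorm_toReal (by norm_num) (by norm_num)]
  simp only [ENNReal.toReal_ofNat, ENNReal.rpow_ofNat]
  rw [← ENNReal.rpow_natCast, ← ENNReal.rpow_mul]
  norm_num

theorem enorm_op_indicator_mul_sq (h : IsCalculus μ j π) {f : X → ℂ} (hf : IsBddMeas f)
    {S : Set X} (hS : MeasurableSet S) (φ : H) :
    ‖op μ j π (S.indicator 1 * f) φ‖ₑ ^ 2 = ∫⁻ x in S, ‖f x‖ₑ ^ 2 ∂(μ φ) := by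
  rw [enorm_op_sq h ((isBddMeas_indicator hS).mul hf), ← lintegral_indicator hS]
  refine lintegral_congr fun x => ?_
  by_cases hx : x ∈ S <;> simp [hx]

theorem enorm_op_indicator_sq (h : IsCalculus μ j π) {S : Set X} (hS : MeasurableSet S) (φ : H) :
    ‖op μ j π (S.indicator 1) φ‖ₑ ^ 2 = μ φ S := by
  simpa using enorm_op_indicator_mul_sq h isBddMeas_one hS φ

theorem measure_op_eq_withDensity (h : IsCalculus μ j π) {f : X → ℂ} (hf : IsBddMeas f) (φ : H) :
    μ (op μ j π f φ) = (μ φ).withDensity fun x => ‖f x‖ₑ ^ 2 := by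
  ext S hS
  rw [withDensity_apply _ hS, ← enorm_op_indicator_mul_sq h hf hS, op_mul h
    (isBddMeas_indicator hS) hf, ← enorm_op_indicator_sq h hS]
  rfl

/-- The projection-valued measure on `ℝ` obtained by transporting a calculus along a measurable
real function. -/
def ProjMeasure.ofCalculus (h : IsCalculus μ j π) {l : X → ℝ} (hl : Measurable l) :
    ProjMeasure H := by
  classical
  exact
  { proj := fun S => if MeasurableSet S then op μ j π ((l ⁻¹' S).indicator 1) else 0
    isStarProjection := by
      intro S hS
      rw [if_pos hS]
      have hb : IsBddMeas ((l ⁻¹' S).indicator (1 : X → ℂ)) := isBddMeas_indicator (hl hS)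
      refine ⟨?_, ?_⟩
      · rw [IsIdempotentElem, ← op_mul h hb hb]
        congr 1
        ext x
        by_cases hx : x ∈ l ⁻¹' S <;> simp [hx]
      · rw [IsSelfAdjoint, ContinuousLinearMap.star_eq_adjoint, ← op_star h hb]
        congr 1
        ext x
        by_cases hx : x ∈ l ⁻¹' S <;> simp [hx]
    not_measurable := fun S hS => if_neg hS
    empty := by
      rw [if_pos MeasurableSet.empty]
      ext φ
      have := enorm_op_indicator_sq h (S := l ⁻¹' ∅) (hl MeasurableSet.empty) φ
      simpa using this
    univ := by
      rw [if_pos MeasurableSet.univ]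
      simpa using op_one h
    hasSum_iUnion := by
      intro S hS hd φ
      have hU := MeasurableSet.iUnion hS
      simp only [if_pos (hS _), if_pos hU]
      have hm : HasSum (fun n => (μ φ).real (l ⁻¹' S n)) ((μ φ).real (l ⁻¹' ⋃ n, S n)) := by
        have := h.finite φ
        rw [preimage_iUnion]
        have hμ := measure_iUnion (μ := μ φ) (fun m n hmn => (hd hmn).preimage l)
          fun n => hl (hS n)
        rw [Measure.real, hμ, ENNReal.tsum_toReal_eq fun n => measure_ne_top _ _]
        exact ENNReal.hasSum_toReal (hμ ▸ measure_ne_top _ _)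
      have hfin : ∀ F : Finset ℕ, Rep μ j π φ (∑ n ∈ F, (l ⁻¹' S n).indicator (1 : X → ℂ))
          (∑ n ∈ F, op μ j π ((l ⁻¹' S n).indicator 1) φ) := by
        intro F
        induction F using Finset.induction_on with
        | empty => simpa using (Rep.one h φ).smul 0
        | insert n F hn ih =>
          rw [Finset.sum_insert hn, Finset.sum_insert hn]
          exact (rep_op h (isBddMeas_indicator (hl (hS n))) φ).add h ih
      -- The two functions differ by the indicator of the sets left out of F, so the squared error
      -- is exactly the remainder of the numerical series.
      have hnorm : ∀ F : Finset ℕ, ‖(∑ n ∈ F, op μ j π ((l ⁻¹' S n).indicator 1) φ) -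
          op μ j π ((l ⁻¹' ⋃ n, S n).indicator 1) φ‖ ^ 2 =
          (μ φ).real (l ⁻¹' ⋃ n, S n) - ∑ n ∈ F, (μ φ).real (l ⁻¹' S n) := by
        intro F
        have := h.finite φ
        rw [((hfin F).sub h (rep_op h (isBddMeas_indicator (hl hU)) φ)).norm_sq_eq h]
        have hi : ∀ T : Set X, MeasurableSet T → Integrable (T.indicator (1 : X → ℝ)) (μ φ) :=
          fun T hT => (integrable_const 1).indicator hT
        have : ∀ x, ‖((∑ n ∈ F, (l ⁻¹' S n).indicator (1 : X → ℂ)) -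
            (l ⁻¹' ⋃ n, S n).indicator (1 : X → ℂ)) x‖ ^ 2 =
            (l ⁻¹' ⋃ n, S n).indicator (1 : X → ℝ) x -
              ∑ n ∈ F, (l ⁻¹' S n).indicator (1 : X → ℝ) x := by
          intro x
          rw [Pi.sub_apply, Finset.sum_apply]
          by_cases hx : ∃ n, l x ∈ S n
          · obtain ⟨n, hn⟩ := hx
            have hx' : x ∈ l ⁻¹' ⋃ n, S n := mem_iUnion.2 ⟨n, hn⟩
            have hne : ∀ m, m ≠ n → x ∉ l ⁻¹' S m := fun m hm hxm =>
              disjoint_left.1 (hd hm) hxm hn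
            have hs : ∀ (k : Type) [inst : Ring k], ∑ m ∈ F, (l ⁻¹' S m).indicator (1 : X → k) x =
                if n ∈ F then 1 else 0 := by
              intro k _
              split_ifs with hnF
              · rw [Finset.sum_eq_single n]
                · exact indicator_of_mem (s := l ⁻¹' S n) hn _
                · intro m _ hm
                  exact indicator_of_notMem (hne m hm) _
                · exact fun h => absurd hnF h
              · refine Finset.sum_eq_zero fun m hm => indicator_of_notMem (hne m ?_) _
                rintro rfl
                exact hnF hm
            rw [hs ℂ, hs ℝ, indicator_of_mem hx', indicator_of_mem hx']
            split_ifs <;> simp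
          · have hx' : x ∉ l ⁻¹' ⋃ n, S n := fun h => hx (mem_iUnion.1 h)
            have hne : ∀ m, x ∉ l ⁻¹' S m := fun m hxm => hx ⟨m, hxm⟩
            rw [indicator_of_notMem hx', indicator_of_notMem hx',
              Finset.sum_eq_zero fun m _ => indicator_of_notMem (hne m) _,
              Finset.sum_eq_zero fun m _ => indicator_of_notMem (hne m) _]
            simp
        simp only [this]
        rw [integral_sub (hi _ (hl hU)) (integrable_finsetSum _ fun n _ => hi _ (hl (hS n))),
          integral_finsetSum _ fun n _ => hi _ (hl (hS n)), integral_indicator_one (hl hU)]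
        simp only [integral_indicator_one (hl (hS _))]
      rw [HasSum, SummationFilter.unconditional_filter, tendsto_iff_norm_sub_tendsto_zero]
      have h2 : Tendsto (fun F : Finset ℕ => ‖(∑ n ∈ F, op μ j π ((l ⁻¹' S n).indicator 1) φ) -
          op μ j π ((l ⁻¹' ⋃ n, S n).indicator 1) φ‖ ^ 2) atTop (𝓝 0) := by
        simp only [hnorm]
        have := (tendsto_const_nhds (x := (μ φ).real (l ⁻¹' ⋃ n, S n))).sub hm
        simpa [SummationFilter.unconditional_filter] using this
      simpa using h2.sqrt }

theorem ProjMeasure.scalar_ofCalculus (h : IsCalculus μ j π) {l : X → ℝ} (hl : Measurable l)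
    (φ : H) : (ProjMeasure.ofCalculus h hl).scalar φ = (μ φ).map l := by
  ext S hS
  rw [Measure.map_apply hl hS, ProjMeasure.scalar_apply_eq_enorm _ _ hS,
    ← enorm_op_indicator_sq h (hl hS)]
  simp [ProjMeasure.ofCalculus, hS]

end Mul

/-! ### Spectral measures of a bounded normal operator -/

section Normal

open scoped CompactlySupported

variable (R : H →L[ℂ] H) [hR : IsStarNormal R]

/-- The continuous functional calculus, as a linear map. -/
def cfcLinear : C(spectrum ℂ R, ℂ) →ₗ[ℂ] H →L[ℂ] H :=
  (cfcHom hR : C(spectrum ℂ R, ℂ) →⋆ₐ[ℂ] (H →L[ℂ] H)).toAlgHom.toLinearMap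

/-- The complex function of a real continuous function. -/
def ofRealMap {K : Type*} [TopologicalSpace K] (f : C(K, ℝ)) : C(K, ℂ) :=
  ⟨fun x => (f x : ℂ), by fun_prop⟩

theorem norm_cfcHom_sq (d : C(spectrum ℂ R, ℂ)) (φ : H) :
    ‖cfcHom hR d φ‖ ^ 2 = (⟪φ, cfcHom hR (star d * d) φ⟫_ℂ).re := by
  rw [map_mul, map_star, mul_apply_eq_comp, ContinuousLinearMap.star_eq_adjoint,
    ContinuousLinearMap.adjoint_inner_right, inner_self_eq_norm_sq_to_K]
  norm_cast

/-- The positive functional `f ↦ (φ, f(R) φ)`. -/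
def cfcFunctional (φ : H) : C_c(spectrum ℂ R, ℝ) →ₚ[ℝ] ℝ :=
  PositiveLinearMap.mk₀
    { toFun := fun f => (⟪φ, cfcHom hR (ofRealMap (f : C(spectrum ℂ R, ℝ))) φ⟫_ℂ).re
      map_add' := fun f g => by
        have : ofRealMap ((f + g : C_c(spectrum ℂ R, ℝ)) : C(spectrum ℂ R, ℝ)) =
            ofRealMap (f : C(spectrum ℂ R, ℝ)) + ofRealMap (g : C(spectrum ℂ R, ℝ)) := by
          ext x
          simp [ofRealMap]
        rw [this, map_add, add_apply, inner_add_right, Complex.add_re]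
      map_smul' := fun c f => by
        have : ofRealMap ((c • f : C_c(spectrum ℂ R, ℝ)) : C(spectrum ℂ R, ℝ)) =
            (c : ℂ) • ofRealMap (f : C(spectrum ℂ R, ℝ)) := by
          ext x
          simp [ofRealMap]
        rw [this, map_smul, smul_apply, inner_smul_right, Complex.re_ofReal_mul]
        rfl }
    (by
      intro f hf
      have : ofRealMap (f : C(spectrum ℂ R, ℝ)) =
          star (ofRealMap ⟨fun x => Real.sqrt (f x), by fun_prop⟩) *
            ofRealMap ⟨fun x => Real.sqrt (f x), by fun_prop⟩ := by
        ext x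
        have h0 : 0 ≤ f x := hf x
        simp [ofRealMap, ← Complex.ofReal_mul, Real.mul_self_sqrt h0]
      change 0 ≤ (⟪φ, cfcHom hR (ofRealMap (f : C(spectrum ℂ R, ℝ))) φ⟫_ℂ).re
      rw [this, ← norm_cfcHom_sq]
      positivity)

/-- The spectral measure of a vector on the spectrum of a normal operator. -/
def cfcMeasure (φ : H) : Measure (spectrum ℂ R) := RealRMK.rieszMeasure (cfcFunctional R φ)

instance (φ : H) : IsFiniteMeasure (cfcMeasure R φ) := by
  unfold cfcMeasure
  infer_instance

theorem isBddMeas_coe (d : C(spectrum ℂ R, ℂ)) : IsBddMeas (d : spectrum ℂ R → ℂ) :=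
  ⟨d.continuous.measurable, ‖d‖, d.norm_coe_le_norm⟩

/-- The norm identity is ‖d(R)φ‖² = ⟨φ, |d|²(R) φ⟩ = ∫ |d|², the second equality being Riesz
representation; density is that of continuous functions in L² of a finite measure. -/
theorem isCalculus_cfc :
    IsCalculus (cfcMeasure R) (ContinuousMap.coeFnLinearMap ℂ) (cfcLinear R) where
  finite φ := inferInstance
  memLp d φ := (isBddMeas_coe R d).memLp _ _
  dense ν _ f hf ε hε := by
    obtain ⟨g, hg, -⟩ := hf.exists_boundedContinuous_eLpNorm_sub_le (by norm_num) hε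
    exact ⟨g.toContinuousMap, hg⟩
  enorm_apply d φ := by
    refine enorm_eq_eLpNorm_two ?_
    let f : C_c(spectrum ℂ R, ℝ) :=
      ⟨⟨fun x => ‖d x‖ ^ 2, by fun_prop⟩, HasCompactSupport.of_compactSpace _⟩
    have h1 : star d * d = ofRealMap (f : C(spectrum ℂ R, ℝ)) := by
      ext x
      simp [ofRealMap, f, Complex.conj_mul']
    have h2 : ‖cfcHom hR d φ‖ ^ 2 = ∫ x, f x ∂(cfcMeasure R φ) := by
      rw [cfcMeasure, RealRMK.integral_rieszMeasure, norm_cfcHom_sq, h1]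
      rfl
    change ‖cfcHom hR d φ‖ₑ ^ 2 = ∫⁻ x, ‖d x‖ₑ ^ 2 ∂_
    rw [← ofReal_norm, ← ENNReal.ofReal_pow (norm_nonneg _), h2, ofReal_integral_eq_lintegral_ofReal]
    · refine lintegral_congr fun x => ?_
      rw [← ofReal_norm, ← ENNReal.ofReal_pow (norm_nonneg _)]
      rfl
    · exact f.continuous.integrable_of_hasCompactSupport f.hasCompactSupport
    · exact ae_of_all _ fun x => by simp [f]
  exists_one := ⟨1, rfl, map_one (cfcHom hR)⟩

end Normal

/-! ### Resolvents and the spectral measure of a self-adjoint operator -/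

theorem norm_sq_apply_add_smul {A : H →ₗ.[ℂ] H} (hA : IsSelfAdjoint A) {c : ℂ}
    (hc : (starRingEnd ℂ) c = -c) (φ : A.domain) :
    ‖A φ + c • (φ : H)‖ ^ 2 = ‖A φ‖ ^ 2 + ‖c‖ ^ 2 * ‖(φ : H)‖ ^ 2 := by
  have h1 : (⟪A φ, c • (φ : H)⟫_ℂ).re = 0 := by
    have h2 : (starRingEnd ℂ) ⟪A φ, c • (φ : H)⟫_ℂ = - ⟪A φ, c • (φ : H)⟫_ℂ := by
      rw [inner_conj_symm, inner_smul_left, inner_smul_right, hc, isFormalAdjoint_self hA]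
      ring
    have := congrArg Complex.re h2
    rw [Complex.conj_re, Complex.neg_re] at this
    linarith
  rw [norm_add_sq (𝕜 := ℂ), norm_smul, mul_pow]
  simp only [RCLike.re_to_complex, h1]
  ring

theorem mem_graph_of_inner {A : H →ₗ.[ℂ] H} (hA : IsSelfAdjoint A) {η χ : H}
    (h : ∀ φ : A.domain, ⟪η, A φ⟫_ℂ = ⟪χ, (φ : H)⟫_ℂ) : (η, χ) ∈ A.graph := by
  have hd : η ∈ A.adjoint.domain :=
    LinearPMap.mem_adjoint_domain_of_exists η ⟨χ, fun φ => (h φ).symm⟩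
  have he := LinearPMap.adjoint_apply_eq hA.dense_domain ⟨η, hd⟩ fun φ => (h φ).symm
  have : (η, χ) ∈ A.adjoint.graph := (LinearPMap.mem_graph_iff _).2 ⟨⟨η, hd⟩, rfl, he⟩
  rwa [LinearPMap.isSelfAdjoint_def.1 hA] at this

/-- On the closed graph the map (φ, Aφ) ↦ Aφ + cφ is bounded below, since ‖Aφ + cφ‖² = ‖Aφ‖² + ‖φ‖²
for c imaginary of modulus 1. Its range is therefore closed, and it remains to see that the range is
dense. -/
theorem exists_resolvent {A : H →ₗ.[ℂ] H} (hA : IsSelfAdjoint A) {c : ℂ}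
    (hc : (starRingEnd ℂ) c = -c) (hc1 : ‖c‖ = 1) :
    ∃ R : H →L[ℂ] H, (∀ ψ, (R ψ, ψ - c • R ψ) ∈ A.graph) ∧
      ∀ φ : A.domain, R (A φ + c • (φ : H)) = φ := by
  let T : A.graph →ₗ[ℂ] H :=
    ((LinearMap.snd ℂ H H) + c • (LinearMap.fst ℂ H H)).comp A.graph.subtype
  have hT : ∀ p : A.graph, ‖p‖ ≤ ‖T p‖ := by
    rintro ⟨⟨x, y⟩, hp⟩
    obtain ⟨φ, rfl, rfl⟩ := (LinearPMap.mem_graph_iff _).1 hp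
    change max ‖(φ : H)‖ ‖A φ‖ ≤ ‖A φ + c • (φ : H)‖
    have h1 := norm_sq_apply_add_smul hA hc φ
    rw [hc1] at h1
    refine max_le ?_ ?_
    · refine abs_le_of_sq_le_sq' ?_ (norm_nonneg _) |>.2
      nlinarith [sq_nonneg ‖A φ‖]
    · refine abs_le_of_sq_le_sq' ?_ (norm_nonneg _) |>.2
      nlinarith [sq_nonneg ‖(φ : H)‖]
  have hcl : IsClosed (A.graph : Set (H × H)) := hA.isClosed
  have : CompleteSpace A.graph := hcl.completeSpace_coe
  have hTc : Continuous T := by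
    change Continuous fun p : A.graph => (p : H × H).2 + c • (p : H × H).1
    fun_prop
  have hanti : AntilipschitzWith 1 T :=
    AddMonoidHomClass.antilipschitz_of_bound T fun p => by simpa using hT p
  have hunif : UniformContinuous T :=
    (⟨T, hTc⟩ : A.graph →L[ℂ] H).uniformContinuous
  have hrange : IsClosed (LinearMap.range T : Set H) := by
    rw [LinearMap.coe_range]
    exact hanti.isClosed_range hunif
  -- A vector η orthogonal to the range satisfies Aη = cη by self-adjointness, and the norm identity
  -- for -c forces η = 0.
  have hsurj : LinearMap.range T = ⊤ := by
    have : CompleteSpace (LinearMap.range T) := hrange.completeSpace_coe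
    rw [← Submodule.orthogonal_eq_bot_iff, Submodule.eq_bot_iff]
    intro η hη
    have h1 : ∀ φ : A.domain, ⟪η, A φ⟫_ℂ = ⟪c • η, (φ : H)⟫_ℂ := by
      intro φ
      have : ⟪η, A φ + c • (φ : H)⟫_ℂ = 0 :=
        (Submodule.mem_orthogonal' _ _).1 hη _ ⟨⟨(φ, A φ), A.mem_graph φ⟩, rfl⟩
      rw [inner_add_right, inner_smul_right] at this
      rw [inner_smul_left, hc]
      linear_combination this
    obtain ⟨φ, h2, h3⟩ := (LinearPMap.mem_graph_iff _).1 (mem_graph_of_inner hA h1)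
    simp only at h2 h3
    have hc' : (starRingEnd ℂ) (-c) = - -c := by rw [map_neg, hc]
    have h4 := norm_sq_apply_add_smul hA hc' φ
    have h5 : A φ + (-c) • (φ : H) = 0 := by rw [h3, h2]; simp
    rw [h5, norm_neg, hc1, h2, norm_zero] at h4
    have h6 : ‖η‖ ^ 2 = 0 := by nlinarith [sq_nonneg ‖A φ‖, sq_nonneg ‖η‖]
    simpa using h6
  have hinj : Function.Injective T := hanti.injective
  let e : A.graph ≃ₗ[ℂ] H := LinearEquiv.ofBijective T ⟨hinj, LinearMap.range_eq_top.1 hsurj⟩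
  let R₀ : H →ₗ[ℂ] H := (LinearMap.fst ℂ H H).comp (A.graph.subtype.comp e.symm.toLinearMap)
  have hR₀ : ∀ ψ, ‖R₀ ψ‖ ≤ 1 * ‖ψ‖ := by
    intro ψ
    have h1 := hT (e.symm ψ)
    have h2 : T (e.symm ψ) = ψ := e.apply_symm_apply ψ
    rw [h2] at h1
    rw [one_mul]
    exact (norm_fst_le _).trans h1
  refine ⟨R₀.mkContinuous 1 hR₀, fun ψ => ?_, fun φ => ?_⟩
  · have h2 : ((e.symm ψ : A.graph) : H × H).2 + c • ((e.symm ψ : A.graph) : H × H).1 = ψ :=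
      e.apply_symm_apply ψ
    have h3 : ψ - c • ((e.symm ψ : A.graph) : H × H).1 = ((e.symm ψ : A.graph) : H × H).2 := by
      rw [sub_eq_iff_eq_add]; exact h2.symm
    change (((e.symm ψ : A.graph) : H × H).1, ψ - c • ((e.symm ψ : A.graph) : H × H).1) ∈ _
    rw [h3]
    exact (e.symm ψ).2
  · have h2 : e ⟨(φ, A φ), A.mem_graph φ⟩ = A φ + c • (φ : H) := rfl
    change ((e.symm (A φ + c • (φ : H)) : A.graph) : H × H).1 = φ
    rw [← h2, e.symm_apply_apply]

/-- The resolvent of a self-adjoint operator at `-i` is normal. -/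
theorem exists_normal_resolvent {A : H →ₗ.[ℂ] H} (hA : IsSelfAdjoint A) :
    ∃ R : H →L[ℂ] H, IsStarNormal R ∧ R - star R = (-2 * Complex.I) • (star R * R) ∧
      (∀ ψ, (R ψ, ψ - Complex.I • R ψ) ∈ A.graph) ∧
      ∀ φ : A.domain, R (A φ + Complex.I • (φ : H)) = φ := by
  obtain ⟨R, hR, hR'⟩ := exists_resolvent hA (c := Complex.I) (by simp) (by simp)
  obtain ⟨Q, hQ, hQ'⟩ := exists_resolvent hA (c := -Complex.I) (by simp) (by simp)
  have hadj : star R = Q := by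
    rw [ContinuousLinearMap.star_eq_adjoint]
    symm
    rw [ContinuousLinearMap.eq_adjoint_iff]
    intro x y
    obtain ⟨u, hu, hu'⟩ := (LinearPMap.mem_graph_iff _).1 (hQ x)
    obtain ⟨v, hv, hv'⟩ := (LinearPMap.mem_graph_iff _).1 (hR y)
    simp only at hu hu' hv hv'
    have hx : x = A u - Complex.I • (u : H) := by rw [hu', hu]; module
    have hy : y = A v + Complex.I • (v : H) := by rw [hv', hv]; module
    rw [← hu, ← hv]
    conv_lhs => rw [hy]
    conv_rhs => rw [hx]
    rw [inner_add_right, inner_sub_left, inner_smul_left, inner_smul_right,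
      isFormalAdjoint_self hA, Complex.conj_I]
    ring
  -- The resolvent identity, here and in the opposite order below; comparing the two gives QR = RQ,
  -- which is normality because Q = R*.
  have h1 : R - Q = (-2 * Complex.I) • (Q * R) := by
    ext ψ
    obtain ⟨u, hu, hu'⟩ := (LinearPMap.mem_graph_iff _).1 (hR ψ)
    simp only at hu hu'
    have hψ : ψ = (A u + (-Complex.I) • (u : H)) + (2 * Complex.I) • (u : H) := by
      rw [hu', hu]; module
    have : Q ψ = u + (2 * Complex.I) • Q u := by
      conv_lhs => rw [hψ]
      rw [map_add, hQ', map_smul]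
    simp only [sub_apply, smul_apply, mul_apply_eq_comp]
    rw [this, ← hu]
    module
  have h2 : R - Q = (-2 * Complex.I) • (R * Q) := by
    ext ψ
    obtain ⟨u, hu, hu'⟩ := (LinearPMap.mem_graph_iff _).1 (hQ ψ)
    simp only at hu hu'
    have hψ : ψ = (A u + Complex.I • (u : H)) + (-2 * Complex.I) • (u : H) := by
      rw [hu', hu]; module
    have : R ψ = u + (-2 * Complex.I) • R u := by
      conv_lhs => rw [hψ]
      rw [map_add, hR', map_smul]
    simp only [sub_apply, smul_apply, mul_apply_eq_comp]
    rw [this, ← hu]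
    module
  refine ⟨R, ⟨?_⟩, ?_, hR, hR'⟩
  · rw [hadj]
    have : (-2 * Complex.I) ≠ 0 := by simp
    exact smul_right_injective _ this (h1.symm.trans h2)
  · rw [hadj]
    exact h1

/-- With R = (A + i)⁻¹, a spectral point z of R stands for 1/(λ + i). Pushing the measures of R
forward along z ↦ λ gives the spectral measure of A. -/
theorem exists_isSpectralMeasureOf {A : H →ₗ.[ℂ] H} (hA : IsSelfAdjoint A) :
    ∃ E : ProjMeasure H, IsSpectralMeasureOf A E := by
  obtain ⟨R, hRn, hRR, hR, hR'⟩ := exists_normal_resolvent hA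
  have hcalc := isCalculus_cfc R
  let ι : C(spectrum ℂ R, ℂ) := (ContinuousMap.id ℂ).restrict (spectrum ℂ R)
  have hι : IsBddMeas (fun z : spectrum ℂ R => (z : ℂ)) := isBddMeas_coe R ι
  have hopι : op (cfcMeasure R) (ContinuousMap.coeFnLinearMap ℂ) (cfcLinear R)
      (fun z : spectrum ℂ R => (z : ℂ)) = R := by
    have h1 := op_coe hcalc ι (isBddMeas_coe R ι)
    have h2 : cfcLinear R ι = R := cfcHom_id hRn
    rw [h2] at h1
    exact h1
  have hrepR : ∀ ψ, Rep (cfcMeasure R) (ContinuousMap.coeFnLinearMap ℂ) (cfcLinear R) ψ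
      (fun z : spectrum ℂ R => (z : ℂ)) (R ψ) := by
    intro ψ
    have := rep_op hcalc hι ψ
    rwa [hopι] at this
  -- The relation R - R* = -2i R*R passes to functions on the spectrum by injectivity of the
  -- functional calculus. It says that 1/z has imaginary part 1 whenever z ≠ 0.
  have hK : ∀ z : spectrum ℂ R, (z : ℂ).im = - ‖(z : ℂ)‖ ^ 2 := by
    intro z
    have h1 : ι - star ι = (-2 * Complex.I) • (star ι * ι) := by
      refine cfcHom_injective hRn ?_
      have h2 : cfcHom hRn ι = R := cfcHom_id hRn
      rw [map_sub, map_smul, map_mul, map_star, h2]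
      exact hRR
    have h2 := congrArg (fun f : C(spectrum ℂ R, ℂ) => (f z).im) h1
    have h3 : ((z : ℂ) - (starRingEnd ℂ) (z : ℂ)).im =
        ((-2 * Complex.I) * ((starRingEnd ℂ) (z : ℂ) * (z : ℂ))).im := h2
    rw [Complex.conj_mul'] at h3
    have h4 : ((-2 * Complex.I) * ((‖(z : ℂ)‖ : ℂ) ^ 2)).im = -2 * ‖(z : ℂ)‖ ^ 2 := by
      rw [← Complex.ofReal_pow, Complex.im_mul_ofReal]
      simp
    rw [h4, Complex.sub_im, Complex.conj_im] at h3
    linarith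
  -- At z = 0 this takes the default value 0, which is harmless because that point carries no mass.
  let l : spectrum ℂ R → ℝ := fun z => ((z : ℂ)⁻¹).re
  have hl : Measurable l := Complex.measurable_re.comp (measurable_subtype_coe.inv)
  have hinv : ∀ z : spectrum ℂ R, (z : ℂ) ≠ 0 → (z : ℂ)⁻¹ = l z + Complex.I := by
    intro z hz
    apply Complex.ext
    · simp [l]
    · rw [Complex.inv_im, hK z, Complex.normSq_eq_norm_sq]
      have : ‖(z : ℂ)‖ ^ 2 ≠ 0 := by simpa using hz
      simp [this]
  -- The spectral projection of {0} maps into the kernel of R, and R is injective.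
  have hzero : ∀ φ, cfcMeasure R φ {z | (z : ℂ) = 0} = 0 := by
    intro φ
    have hS : MeasurableSet {z : spectrum ℂ R | (z : ℂ) = 0} :=
      measurable_subtype_coe (measurableSet_singleton 0)
    rw [← enorm_op_indicator_sq hcalc hS]
    set P := op (cfcMeasure R) (ContinuousMap.coeFnLinearMap ℂ) (cfcLinear R)
      ({z : spectrum ℂ R | (z : ℂ) = 0}.indicator 1)
    have h1 : R * P = 0 := by
      conv_lhs => rw [← hopι]
      rw [← op_mul hcalc hι (isBddMeas_indicator hS)]
      refine op_eq_of_inner hcalc (hι.mul (isBddMeas_indicator hS)) fun φ => ?_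
      have : ((fun z : spectrum ℂ R => (z : ℂ)) *
          ({z : spectrum ℂ R | (z : ℂ) = 0}.indicator (1 : spectrum ℂ R → ℂ))) = 0 := by
        ext z
        by_cases hz : (z : ℂ) = 0 <;> simp [hz]
      rw [this]
      simp
    have h2 : R (P φ) = 0 := congrArg (fun T : H →L[ℂ] H => T φ) h1
    have h3 := hR (P φ)
    rw [h2, smul_zero, sub_zero] at h3
    have h4 := LinearPMap.graph_fst_eq_zero_snd A h3 rfl
    simp [h4]
  refine ⟨ProjMeasure.ofCalculus hcalc hl, ?_, ?_⟩
  · intro φ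
    have hm : Measurable fun x : ℝ => ENNReal.ofReal (x ^ 2) := by fun_prop
    rw [ProjMeasure.scalar_ofCalculus, lintegral_map hm hl]
    constructor
    -- Here φ = Rψ, so the measure of φ is |z|² times that of ψ, and |z l(z)| ≤ 1 bounds the
    -- integral.
    · intro hφ
      have h1 := hR' ⟨φ, hφ⟩
      set ψ := A ⟨φ, hφ⟩ + Complex.I • φ
      have h2 : R ψ = φ := h1
      have h3 := measure_op_eq_withDensity hcalc hι ψ
      rw [hopι, h2] at h3
      rw [h3]
      refine (lintegral_withDensity_eq_lintegral_mul _ (hι.1.enorm.pow_const 2)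
        (hm.comp hl)).trans_lt ?_
      refine (lintegral_mono (g := fun _ => 1) fun z => ?_).trans_lt (by simp)
      simp only [Pi.mul_apply, Function.comp]
      rw [← ofReal_norm, ← ENNReal.ofReal_pow (norm_nonneg _), ← ENNReal.ofReal_mul (by positivity)]
      refine ENNReal.ofReal_le_one.2 ?_
      have h4 : |l z| ≤ ‖(z : ℂ)‖⁻¹ := by
        rw [← norm_inv]; exact Complex.abs_re_le_norm _
      by_cases hz : (z : ℂ) = 0
      · simp [hz]
      · have hz' : 0 < ‖(z : ℂ)‖ := norm_pos_iff.2 hz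
        rw [← mul_pow, ← abs_of_nonneg hz'.le, ← sq_abs, abs_mul, abs_abs]
        have : |‖(z : ℂ)‖| * |l z| ≤ 1 := by
          rw [abs_of_nonneg hz'.le]
          calc _ ≤ ‖(z : ℂ)‖ * ‖(z : ℂ)‖⁻¹ := mul_le_mul_of_nonneg_left h4 hz'.le
            _ = 1 := mul_inv_cancel₀ hz'.ne'
        exact pow_le_one₀ (by positivity) this
    -- Conversely λ + i is square integrable and represents some ψ; since z (λ + i) = 1 almost
    -- everywhere, Rψ = φ lies in the domain.
    · intro hfin
      have hne : ∀ᵐ z ∂(cfcMeasure R φ), ((z : spectrum ℂ R) : ℂ) ≠ 0 := by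
        have := hzero φ
        rw [ae_iff]
        simp only [ne_eq, not_not]
        exact this
      have hL2 : MemLp (fun z : spectrum ℂ R => ((l z : ℝ) : ℂ)) 2 (cfcMeasure R φ) := by
        have hm' : AEStronglyMeasurable (fun z : spectrum ℂ R => ((l z : ℝ) : ℂ))
          (cfcMeasure R φ) := (Complex.measurable_ofReal.comp hl).aestronglyMeasurable
        rw [memLp_two_iff_integrable_sq_norm hm']
        refine ⟨(hm'.norm.pow 2), ?_⟩
        rw [HasFiniteIntegral]
        convert hfin using 2
        ext z
        rw [Real.enorm_of_nonneg (by positivity)]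
        simp
      have hf : MemLp (fun z : spectrum ℂ R => ((l z : ℝ) : ℂ) + Complex.I) 2 (cfcMeasure R φ) :=
        hL2.add (memLp_const _)
      obtain ⟨ψ, hψ⟩ := Rep.exists hcalc φ hf
      have h1 := hψ.mul hcalc (isBddMeas_coe R) hι
      rw [hopι] at h1
      have h2 := h1.congr_ae (g := 1) (by
        filter_upwards [hne] with z hz
        rw [Pi.mul_apply, ← hinv z hz, mul_inv_cancel₀ hz]
        rfl)
      have h3 := h2.unique hcalc (Rep.one hcalc φ)
      obtain ⟨u, hu, -⟩ := (LinearPMap.mem_graph_iff _).1 (hR ψ)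
      rw [← h3]
      simp only at hu
      exact hu ▸ u.2
  · intro φ
    have h1 := hR' φ
    set ψ := A φ + Complex.I • (φ : H) with hψ
    have h2 : A φ = ψ - Complex.I • R ψ := by rw [h1, hψ]; module
    have h3 := measure_op_eq_withDensity hcalc hι ψ
    rw [hopι, h1] at h3
    have h4 : ⟪(φ : H), A φ⟫_ℂ = ∫ z, (starRingEnd ℂ) (z : ℂ) *
        ((1 : spectrum ℂ R → ℂ) - Complex.I • fun z : spectrum ℂ R => (z : ℂ)) z
          ∂(cfcMeasure R ψ) := by
      rw [h2, ← h1]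
      exact (hrepR ψ).inner_eq hcalc ((Rep.one hcalc ψ).sub hcalc ((hrepR ψ).smul Complex.I))
    rw [h4, ProjMeasure.scalar_ofCalculus, integral_map hl.aemeasurable
      (f := fun x : ℝ => x) measurable_id.aestronglyMeasurable, h3]
    have h5 : (fun z : spectrum ℂ R => ‖(z : ℂ)‖ₑ ^ 2) =
        fun z : spectrum ℂ R => ((‖(z : ℂ)‖₊ ^ 2 : NNReal) : ℝ≥0∞) := by
      ext z
      simp [enorm_eq_nnnorm]
    rw [h5, integral_withDensity_eq_integral_smul ((hι.1.nnnorm).pow_const 2),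
      ← integral_complex_ofReal]
    refine integral_congr_ae (ae_of_all _ fun z => ?_)
    simp only [Pi.sub_apply, Pi.one_apply, Pi.smul_apply, smul_eq_mul, NNReal.smul_def,
      NNReal.coe_pow, coe_nnnorm, Complex.ofReal_mul, Complex.ofReal_pow]
    by_cases hz : (z : ℂ) = 0
    · simp [hz]
    · rw [← Complex.conj_mul', mul_assoc]
      congr 1
      have : (l z : ℂ) = (z : ℂ)⁻¹ - Complex.I := by rw [hinv z hz]; ring
      rw [this, mul_sub, mul_inv_cancel₀ hz]
      ring

theorem isSpectralMeasureOf_spectralMeasure {B : H →ₗ.[ℂ] H} (hB : IsSelfAdjoint B) :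
    IsSpectralMeasureOf B (spectralMeasure B) := by
  have h := exists_isSpectralMeasureOf hB
  rw [spectralMeasure, dif_pos h]
  exact h.choose_spec

theorem isUnitaryGroupOf_expI_of_isSelfAdjoint {B : H →ₗ.[ℂ] H} (hB : IsSelfAdjoint B) :
    IsUnitaryGroupOf B (expI B) :=
  isUnitaryGroupOf_expI ((isSpectralMeasureOf_spectralMeasure hB).isUnitaryGroupOf hB)

/-! ### Square integrability of matrix elements of the unitary group -/

section Plancherel

open scoped FourierTransform Convolution ComplexConjugate

theorem fourier_conj_neg (g : ℝ → ℂ) (w : ℝ) :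
    𝓕 (fun v => conj (g (-v))) w = conj (𝓕 g w) := by
  rw [Real.fourier_real_eq_integral_exp_smul, Real.fourier_real_eq_integral_exp_smul,
    ← integral_conj, ← integral_neg_eq_self]
  congr 1
  ext v
  simp only [smul_eq_mul, map_mul, neg_neg, ← Complex.exp_conj, Complex.conj_I,
    Complex.conj_ofReal]
  congr 2
  push_cast
  ring

/-- Fourier inversion at 0 with a Gaussian factor, so that the transform need not be integrable.
Moving the transform onto the Gaussian turns the integral into an approximate identity applied to f.
-/
theorem tendsto_integral_gaussian_mul_fourier {f : ℝ → ℂ} (hf : Integrable f)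
    (hc : ContinuousAt f 0) :
    Tendsto (fun c : ℝ => ∫ w : ℝ, Complex.exp (-c⁻¹ * ‖w‖ ^ 2) * 𝓕 f w) atTop (𝓝 (f 0)) := by
  have h := Real.tendsto_integral_gaussian_smul' hf hc
  refine h.congr' ?_
  filter_upwards [Ioi_mem_atTop 0] with c (hc0 : 0 < c)
  have J : Integrable (fun w : ℝ => Complex.exp (-c⁻¹ * ‖w‖ ^ 2 +
      2 * Real.pi * Complex.I * ⟪(0 : ℝ), w⟫_ℝ)) :=
    GaussianFourier.integrable_cexp_neg_mul_sq_norm_add (by simpa) _ _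
  have h1 := (VectorFourier.integral_fourierIntegral_smul_eq_flip (L := innerₗ ℝ)
      Real.continuous_fourierChar continuous_inner J hf)
  have h2 : ∀ w : ℝ, 𝓕 (fun w : ℝ => Complex.exp (-c⁻¹ * ‖w‖ ^ 2 +
      2 * Real.pi * Complex.I * ⟪(0 : ℝ), w⟫_ℝ)) w =
      ((Real.pi * c : ℂ) ^ (Module.finrank ℝ ℝ / 2 : ℂ) *
        Complex.exp (-Real.pi ^ 2 * c * ‖0 - w‖ ^ 2)) := by
    intro w
    rw [fourier_gaussian_innerProductSpace' (by simpa)]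
    congr
    · simp
    · simp
      ring
  simp only [← h2]
  refine Eq.trans ?_ (h1.trans ?_)
  · rfl
  · simp only [inner_zero_left, Complex.ofReal_zero, mul_zero, add_zero, smul_eq_mul]
    simp
    rfl

/-- The half of Plancherel that is needed. For f = g ∗ g', with g' the conjugate reflection of g,
the transform of f is |ĝ|² and f(0) = ∫ |g|²; the Gaussian means converge to f(0), and Fatou removes
the Gaussian. -/
theorem lintegral_fourier_sq_le {g : ℝ → ℂ} (hg : Continuous g) (hc : HasCompactSupport g) :
    ∫⁻ w, ‖𝓕 g w‖ₑ ^ 2 ≤ ∫⁻ v, ‖g v‖ₑ ^ 2 := by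
  have hgi : Integrable g := hg.integrable_of_hasCompactSupport hc
  let g' : ℝ → ℂ := fun v => conj (g (-v))
  have hg' : Continuous g' := by fun_prop
  have hc' : HasCompactSupport g' :=
    (hc.comp_homeomorph (Homeomorph.neg ℝ)).comp_left (g := conj) (by simp)
  have hgi' : Integrable g' := hg'.integrable_of_hasCompactSupport hc'
  let f := g ⋆[ContinuousLinearMap.mul ℂ ℂ, volume] g'
  have hf : Integrable f := hgi.integrable_convolution _ hgi'
  have hfc : Continuous f :=
    hc'.continuous_convolution_right _ hgi.locallyIntegrable hg'
  have hFf : ∀ w, 𝓕 f w = ((‖𝓕 g w‖ ^ 2 : ℝ) : ℂ) := by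
    intro w
    rw [Real.fourier_mul_convolution_eq hgi hgi', fourier_conj_neg, Complex.mul_conj']
    push_cast
    rfl
  have hf0 : f 0 = ((∫ v, ‖g v‖ ^ 2 : ℝ) : ℂ) := by
    rw [← integral_complex_ofReal]
    refine integral_congr_ae (ae_of_all _ fun v => ?_)
    simp only [g', ContinuousLinearMap.mul_apply', zero_sub, neg_neg]
    rw [Complex.mul_conj']
    push_cast
    rfl
  have hFg : Continuous (𝓕 g) :=
    VectorFourier.fourierIntegral_continuous Real.continuous_fourierChar
      (by exact continuous_inner) hgi
  have hbound : ∀ w, ‖𝓕 g w‖ ≤ ∫ v, ‖g v‖ := fun w =>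
    VectorFourier.norm_fourierIntegral_le_integral_norm _ _ _ _ _
  have hlim : Tendsto (fun n : ℕ => ∫ w : ℝ, Real.exp (-((n : ℝ) + 1)⁻¹ * w ^ 2) * ‖𝓕 g w‖ ^ 2)
      atTop (𝓝 (∫ v, ‖g v‖ ^ 2)) := by
    have h1 := (tendsto_integral_gaussian_mul_fourier hf hfc.continuousAt).comp
      (tendsto_atTop_add_const_right atTop (1 : ℝ) tendsto_natCast_atTop_atTop)
    rw [hf0] at h1
    have h2 := (Complex.continuous_re.tendsto _).comp h1
    rw [Complex.ofReal_re] at h2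
    refine h2.congr fun n => ?_
    simp only [Function.comp, hFf]
    rw [← Complex.ofReal_re (∫ w : ℝ, Real.exp (-((n : ℝ) + 1)⁻¹ * w ^ 2) * ‖𝓕 g w‖ ^ 2),
      ← integral_complex_ofReal]
    congr 2
    ext w
    push_cast
    rw [← Complex.ofReal_pow ‖w‖, Real.norm_eq_abs, sq_abs]
    push_cast
    rfl
  have hint : ∀ n : ℕ, Integrable fun w : ℝ =>
      Real.exp (-((n : ℝ) + 1)⁻¹ * w ^ 2) * ‖𝓕 g w‖ ^ 2 := by
    intro n
    refine (integrable_exp_neg_mul_sq (b := ((n : ℝ) + 1)⁻¹) (by positivity)).mul_bdd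
      (c := (∫ v, ‖g v‖) ^ 2) (by fun_prop) (ae_of_all _ fun w => ?_)
    rw [Real.norm_of_nonneg (by positivity)]
    exact pow_le_pow_left₀ (norm_nonneg _) (hbound w) 2
  have hpt : ∀ w : ℝ, ‖𝓕 g w‖ₑ ^ 2 = liminf (fun n : ℕ => ENNReal.ofReal
      (Real.exp (-((n : ℝ) + 1)⁻¹ * w ^ 2) * ‖𝓕 g w‖ ^ 2)) atTop := by
    intro w
    have h0 : Tendsto (fun n : ℕ => ((n : ℝ) + 1)⁻¹) atTop (𝓝 0) := by
      simpa using tendsto_one_div_add_atTop_nhds_zero_nat (𝕜 := ℝ)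
    have h1 : Tendsto (fun n : ℕ => Real.exp (-((n : ℝ) + 1)⁻¹ * w ^ 2) * ‖𝓕 g w‖ ^ 2) atTop
        (𝓝 (Real.exp (-0 * w ^ 2) * ‖𝓕 g w‖ ^ 2)) :=
      ((Real.continuous_exp.tendsto _).comp (h0.neg.mul_const _)).mul_const _
    have h2 := ENNReal.tendsto_ofReal h1
    rw [h2.liminf_eq, ← ofReal_norm, ← ENNReal.ofReal_pow (norm_nonneg _)]
    simp
  simp only [hpt]
  refine (lintegral_liminf_le fun n => by fun_prop).trans ?_
  have h3 : Tendsto (fun n : ℕ => ∫⁻ w : ℝ, ENNReal.ofReal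
      (Real.exp (-((n : ℝ) + 1)⁻¹ * w ^ 2) * ‖𝓕 g w‖ ^ 2)) atTop
      (𝓝 (ENNReal.ofReal (∫ v, ‖g v‖ ^ 2))) := by
    have := ENNReal.tendsto_ofReal hlim
    refine this.congr fun n => ?_
    rw [ofReal_integral_eq_lintegral_ofReal (hint n) (ae_of_all _ fun w => by positivity)]
  rw [h3.liminf_eq, ofReal_integral_eq_lintegral_ofReal]
  · refine le_of_eq (lintegral_congr fun v => ?_)
    rw [← ofReal_norm, ← ENNReal.ofReal_pow (norm_nonneg _)]
  · have h4 : Continuous fun v => ‖g v‖ ^ 2 := by fun_prop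
    exact h4.integrable_of_hasCompactSupport (hc.norm.comp_left (g := fun x => x ^ 2) (by simp))
  · exact ae_of_all _ fun v => by positivity

/-- The factor 2π is the Jacobian of the change from frequency w to x = 2πw. -/
theorem lintegral_character_transform_sq_le {g : ℝ → ℂ} (hg : Continuous g)
    (hc : HasCompactSupport g) :
    ∫⁻ x, ‖∫ v, g v * character (-v) x‖ₑ ^ 2 ≤
      ENNReal.ofReal (2 * Real.pi) * ∫⁻ v, ‖g v‖ₑ ^ 2 := by
  have h1 : ∀ x, ∫ v, g v * character (-v) x = 𝓕 g ((2 * Real.pi)⁻¹ * x) := by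
    intro x
    rw [Real.fourier_real_eq_integral_exp_smul]
    congr 1
    ext v
    rw [smul_eq_mul, mul_comm, character]
    congr 4
    field_simp
  have hFg : Continuous (𝓕 g) :=
    VectorFourier.fourierIntegral_continuous Real.continuous_fourierChar
      (by exact continuous_inner) (hg.integrable_of_hasCompactSupport hc)
  simp only [h1]
  have h2 := lintegral_map (μ := volume) (f := fun x : ℝ => ‖𝓕 g x‖ₑ ^ 2)
    (g := fun x : ℝ => (2 * Real.pi)⁻¹ * x) (by fun_prop) (by fun_prop)
  rw [← h2, Real.map_volume_mul_left (by positivity), lintegral_smul_measure, inv_inv,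
    abs_of_nonneg (by positivity), smul_eq_mul]
  exact mul_le_mul_right (lintegral_fourier_sq_le hg hc) _

end Plancherel

section Smooth

open scoped ComplexConjugate

variable {B : H →ₗ.[ℂ] H}

theorem isBddMeas_character_transform {g : ℝ → ℂ} (hg : Continuous g) (hc : HasCompactSupport g) :
    IsBddMeas fun x => ∫ v, g v * character (-v) x := by
  have hgi : Integrable g := hg.integrable_of_hasCompactSupport hc
  refine ⟨?_, ∫ v, ‖g v‖, fun x => ?_⟩
  · have h : Continuous fun p : ℝ × ℝ => g p.2 * character (-p.2) p.1 := by
      unfold character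
      fun_prop
    exact (h.stronglyMeasurable.integral_prod_right' (ν := volume)).measurable
  · refine (norm_integral_le_integral_norm _).trans (le_of_eq ?_)
    simp [norm_character]

/-- Both sides are bounded operators of φ, and by Fubini they have the same quadratic form. -/
theorem integral_smul_expI (hB : IsSelfAdjoint B) {E : ProjMeasure H}
    (hE : IsSpectralMeasureOf B E) {g : ℝ → ℂ} (hg : Continuous g) (hc : HasCompactSupport g)
    (φ : H) :
    ∫ v, g v • expI B (-v) φ = E.integral (fun x => ∫ v, g v * character (-v) x) φ := by
  have hU : IsUnitaryGroupOf B (expI B) := isUnitaryGroupOf_expI (hE.isUnitaryGroupOf hB)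
  have hgi : Integrable g := hg.integrable_of_hasCompactSupport hc
  have hcont : ∀ φ, Continuous fun v => g v • expI B (-v) φ := fun φ =>
    hg.smul ((hU.continuous φ).comp continuous_neg)
  have hi : ∀ φ, Integrable fun v => g v • expI B (-v) φ := fun φ =>
    (hcont φ).integrable_of_hasCompactSupport hc.smul_right
  let T₀ : H →ₗ[ℂ] H :=
    { toFun := fun φ => ∫ v, g v • expI B (-v) φ
      map_add' := fun φ ψ => by
        rw [← integral_add (hi φ) (hi ψ)]
        simp
      map_smul' := fun c φ => by
        rw [RingHom.id_apply, ← integral_smul]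
        simp only [map_smul, smul_comm c] }
  let T : H →L[ℂ] H := T₀.mkContinuous (∫ v, ‖g v‖) fun φ => by
    refine (norm_integral_le_integral_norm _).trans (le_of_eq ?_)
    simp only [norm_smul, hU.norm_apply]
    rw [integral_mul_const]
  have hT : E.integral (fun x => ∫ v, g v * character (-v) x) = T := by
    refine op_eq_of_inner E.isCalculus (isBddMeas_character_transform hg hc) fun φ => ?_
    change ⟪φ, ∫ v, g v • expI B (-v) φ⟫_ℂ = _
    rw [← integral_inner (hi φ) φ]
    simp only [inner_smul_right, hE.inner_expI hB]
    rw [integral_integral_swap]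
    · congr 1
      ext v
      rw [integral_const_mul]
    · have hm : Continuous (Function.uncurry fun x v => g v * character (-v) x) := by
        unfold character
        simp only [Function.uncurry_def]
        fun_prop
      have h1 := (integrable_const (μ := E.scalar φ) (1 : ℝ)).mul_prod hgi.norm
      refine h1.mono' hm.aestronglyMeasurable (ae_of_all _ fun p => ?_)
      simp [Function.uncurry_def, norm_character]
  rw [hT]
  rfl

/-- Duality: testing a(v) = ⟨η, e^{-ivB}φ⟩ against its own truncated conjugate g gives I = ∫ χ|a|² ≤
‖η‖ ‖∫ g(v) e^{-ivB}φ dv‖. The last vector is the transform of g evaluated at B and applied to φ; as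
φ has spectral density at most m², its squared norm is at most 2π m² ∫ |g|² ≤ c I. Hence I² ≤ c ‖η‖²
I. -/
theorem lintegral_inner_expI_sq_le (hB : IsSelfAdjoint B) {φ : H}
    (hφ : φ ∈ boundedDensitySet B) : ∃ c : NNReal, ∀ η : H,
      ∫⁻ v, ‖⟪η, expI B (-v) φ⟫_ℂ‖ₑ ^ 2 ≤ c * ‖η‖ₑ ^ 2 := by
  have hE := isSpectralMeasureOf_spectralMeasure hB
  have hU := isUnitaryGroupOf_expI_of_isSelfAdjoint hB
  set E := spectralMeasure B with hEdef
  obtain ⟨f, hf, hsc⟩ := hφ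
  rw [← hEdef] at hsc
  set m := (eLpNorm f ∞ volume) with hm
  have hmfin : m ≠ ∞ := hf.2.ne
  have hfm : ∀ᵐ x, ‖f x‖ₑ ≤ m := by
    rw [hm, eLpNorm_exponent_top]
    exact enorm_ae_le_eLpNormEssSup f volume
  have hle : E.scalar φ ≤ m ^ 2 • (volume : Measure ℝ) := by
    rw [hsc, ← withDensity_const]
    refine withDensity_mono ?_
    filter_upwards [hfm] with x hx
    gcongr
  set c : ℝ≥0∞ := m ^ 2 * ENNReal.ofReal (2 * Real.pi) with hcdef
  have hcfin : c ≠ ∞ := by finiteness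
  refine ⟨c.toNNReal, fun η => ?_⟩
  rw [ENNReal.coe_toNNReal hcfin]
  let a : ℝ → ℂ := fun v => ⟪η, expI B (-v) φ⟫_ℂ
  have ha : Continuous a :=
    continuous_const.inner ((hU.continuous φ).comp continuous_neg)
  -- The tent cutoff makes I finite, so that it can be divided out; Fatou removes it at the end.
  let χ : ℕ → ℝ → ℝ := fun n v => max 0 (1 - |v| / (n + 1))
  have hχc : ∀ n, Continuous (χ n) := fun n => by fun_prop
  have hχ0 : ∀ n v, 0 ≤ χ n v := fun n v => le_max_left _ _
  have hχ1 : ∀ n v, χ n v ≤ 1 := fun n v => max_le zero_le_one (by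
    have : 0 ≤ |v| / ((n : ℝ) + 1) := by positivity
    linarith)
  have hχs : ∀ n, HasCompactSupport (χ n) := fun n => by
    refine HasCompactSupport.intro (isCompact_Icc (a := -((n : ℝ) + 1)) (b := (n : ℝ) + 1))
      fun v hv => ?_
    have h1 : (n : ℝ) + 1 < |v| := by
      by_contra h
      exact hv (abs_le.1 (not_lt.1 h))
    have h2 : 1 ≤ |v| / ((n : ℝ) + 1) := by
      rw [le_div_iff₀ (by positivity)]; linarith
    exact max_eq_left (by linarith)
  have hχlim : ∀ v, Tendsto (fun n => χ n v) atTop (𝓝 1) := by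
    intro v
    have h0 : Tendsto (fun n : ℕ => |v| / ((n : ℝ) + 1)) atTop (𝓝 0) := by
      simpa [div_eq_mul_inv] using
        (tendsto_one_div_add_atTop_nhds_zero_nat (𝕜 := ℝ)).const_mul |v|
    have := (tendsto_const_nhds (x := (0 : ℝ))).max ((tendsto_const_nhds (x := (1 : ℝ))).sub h0)
    simpa [χ] using this
  have key : ∀ n, ∫⁻ v, ENNReal.ofReal (χ n v) * ‖a v‖ₑ ^ 2 ≤ c * ‖η‖ₑ ^ 2 := by
    intro n
    let g : ℝ → ℂ := fun v => χ n v * conj (a v)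
    have hg : Continuous g := by
      have := hχc n
      fun_prop
    have hgs : HasCompactSupport g := by
      refine HasCompactSupport.mul_right (f := fun v => (χ n v : ℂ)) ?_
      exact (hχs n).comp_left (g := fun x : ℝ => (x : ℂ)) (by simp)
    have hi : Integrable fun v => g v • expI B (-v) φ :=
      (hg.smul ((hU.continuous φ).comp continuous_neg)).integrable_of_hasCompactSupport
        hgs.smul_right
    set I : ℝ≥0∞ := ∫⁻ v, ENNReal.ofReal (χ n v) * ‖a v‖ₑ ^ 2 with hI
    have hIreal : Integrable fun v => χ n v * ‖a v‖ ^ 2 := by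
      have : Continuous fun v => χ n v * ‖a v‖ ^ 2 := (hχc n).mul (ha.norm.pow 2)
      exact this.integrable_of_hasCompactSupport (hχs n).mul_right
    have hIeq : I = ENNReal.ofReal (∫ v, χ n v * ‖a v‖ ^ 2) := by
      rw [ofReal_integral_eq_lintegral_ofReal hIreal
        (ae_of_all _ fun v => mul_nonneg (hχ0 n v) (by positivity))]
      refine lintegral_congr fun v => ?_
      rw [ENNReal.ofReal_mul (hχ0 n v), ENNReal.ofReal_pow (norm_nonneg _), ofReal_norm]
    have hIfin : I ≠ ∞ := by rw [hIeq]; exact ENNReal.ofReal_ne_top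
    have h1 : ⟪η, ∫ v, g v • expI B (-v) φ⟫_ℂ = ((∫ v, χ n v * ‖a v‖ ^ 2 : ℝ) : ℂ) := by
      rw [← integral_inner hi η, ← integral_complex_ofReal]
      congr 1
      ext v
      rw [inner_smul_right]
      change χ n v * conj (a v) * a v = _
      rw [mul_assoc, Complex.conj_mul']
      push_cast
      rfl
    have h2 : I ≤ ‖η‖ₑ * ‖∫ v, g v • expI B (-v) φ‖ₑ := by
      have h3 : ‖⟪η, ∫ v, g v • expI B (-v) φ⟫_ℂ‖ ≤ ‖η‖ * ‖∫ v, g v • expI B (-v) φ‖ :=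
        norm_inner_le_norm _ _
      rw [h1, Complex.norm_real, Real.norm_of_nonneg (integral_nonneg fun v =>
        mul_nonneg (hχ0 n v) (by positivity))] at h3
      rw [hIeq, ← ofReal_norm, ← ofReal_norm, ← ENNReal.ofReal_mul (norm_nonneg _)]
      exact ENNReal.ofReal_le_ofReal h3
    have h4 : ‖∫ v, g v • expI B (-v) φ‖ₑ ^ 2 ≤ c * I := by
      rw [integral_smul_expI hB hE hg hgs]
      refine (enorm_op_sq E.isCalculus (isBddMeas_character_transform hg hgs) φ).trans_le ?_
      refine (lintegral_mono' hle le_rfl).trans ?_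
      rw [lintegral_smul_measure, smul_eq_mul, hcdef, mul_assoc]
      gcongr
      refine (lintegral_character_transform_sq_le hg hgs).trans ?_
      gcongr
      refine lintegral_mono fun v => ?_
      rw [← ofReal_norm, ← ofReal_norm, ← ENNReal.ofReal_pow (norm_nonneg _),
        ← ENNReal.ofReal_pow (norm_nonneg _), ← ENNReal.ofReal_mul (hχ0 n v)]
      refine ENNReal.ofReal_le_ofReal ?_
      have h5 : ‖g v‖ = χ n v * ‖a v‖ := by
        simp [g, abs_of_nonneg (hχ0 n v)]
      rw [h5, mul_pow]
      refine mul_le_mul_of_nonneg_right ?_ (by positivity)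
      rw [sq]
      exact mul_le_of_le_one_left (hχ0 n v) (hχ1 n v)
    have h6 : I * I ≤ (c * ‖η‖ₑ ^ 2) * I := by
      calc I * I = I ^ 2 := (sq I).symm
        _ ≤ (‖η‖ₑ * ‖∫ v, g v • expI B (-v) φ‖ₑ) ^ 2 := by gcongr
        _ = ‖η‖ₑ ^ 2 * ‖∫ v, g v • expI B (-v) φ‖ₑ ^ 2 := mul_pow _ _ _
        _ ≤ ‖η‖ₑ ^ 2 * (c * I) := by gcongr
        _ = _ := by ring
    by_cases hI0 : I = 0
    · rw [hI0]; exact zero_le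
    · exact (ENNReal.mul_le_mul_iff_left hI0 hIfin).1 h6
  have hlim : ∀ v, ‖a v‖ₑ ^ 2 = liminf (fun n => ENNReal.ofReal (χ n v) * ‖a v‖ₑ ^ 2) atTop := by
    intro v
    have h1 := ENNReal.Tendsto.mul_const (b := ‖a v‖ₑ ^ 2) (ENNReal.tendsto_ofReal (hχlim v))
      (Or.inr (by finiteness))
    rw [h1.liminf_eq]
    simp
  change ∫⁻ v, ‖a v‖ₑ ^ 2 ≤ _
  rw [lintegral_congr hlim]
  refine (lintegral_liminf_le fun n => ?_).trans ?_
  · exact ((hχc n).measurable.ennreal_ofReal).mul (ha.measurable.enorm.pow_const 2)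
  · exact liminf_le_of_le (by isBoundedDefault) fun b hb => by
      obtain ⟨n, hn⟩ := hb.exists
      exact hn.trans (key n)

end Smooth

/-! ### Trace class operators as products of Hilbert-Schmidt operators -/

theorem norm_abs_apply (T : H →L[ℂ] H) (y : H) : ‖CFC.abs T y‖ = ‖T y‖ := by
  have hsa : ContinuousLinearMap.adjoint (CFC.abs T) = CFC.abs T :=
    (CFC.abs_nonneg T).isSelfAdjoint
  have h1 : ⟪CFC.abs T y, CFC.abs T y⟫_ℂ = ⟪T y, T y⟫_ℂ := by
    rw [← ContinuousLinearMap.adjoint_inner_right, hsa, ← mul_apply_eq_comp, CFC.abs_mul_abs,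
      mul_apply_eq_comp, ContinuousLinearMap.star_eq_adjoint,
      ContinuousLinearMap.adjoint_inner_right]
  rw [@norm_eq_sqrt_re_inner ℂ, @norm_eq_sqrt_re_inner ℂ, h1]

/-- If `‖T y‖ = ‖D (D y)‖` with `D` self-adjoint, then `T = G D` with `‖G z‖ = ‖D z‖`. -/
theorem exists_factor_of_norm_eq {T D : H →L[ℂ] H} (hD : ContinuousLinearMap.adjoint D = D)
    (hT : ∀ y, ‖T y‖ = ‖D (D y)‖) :
    ∃ G : H →L[ℂ] H, T = G * D ∧ ∀ z, ‖G z‖ = ‖D z‖ := by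
  let K : Submodule ℂ H := (LinearMap.range (D : H →ₗ[ℂ] H)).topologicalClosure
  have hKc : IsClosed (K : Set H) := Submodule.isClosed_topologicalClosure _
  have : CompleteSpace K := hKc.completeSpace_coe
  have hmem : ∀ y, D y ∈ K := fun y =>
    Submodule.le_topologicalClosure _ ⟨y, rfl⟩
  let e : H →ₗ[ℂ] K := (D : H →ₗ[ℂ] H).codRestrict K hmem
  have hdense : DenseRange e := by
    intro k
    rw [closure_subtype]
    have h1 : (Subtype.val '' range e) = range D := by
      ext x
      constructor
      · rintro ⟨_, ⟨y, rfl⟩, rfl⟩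
        exact ⟨y, rfl⟩
      · rintro ⟨y, rfl⟩
        exact ⟨e y, ⟨y, rfl⟩, rfl⟩
    rw [h1]
    exact k.2
  have hbound : ∃ C, ∀ x, ‖(T : H →ₗ[ℂ] H) x‖ ≤ C * ‖e x‖ :=
    ⟨‖D‖, fun x => by
      change ‖T x‖ ≤ ‖D‖ * ‖D x‖
      rw [hT]
      exact D.le_opNorm _⟩
  let G₀ : K →L[ℂ] H := (T : H →ₗ[ℂ] H).extendOfNorm e
  have hG₀ : ∀ y, G₀ (e y) = T y := fun y => LinearMap.extendOfNorm_eq hdense hbound y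
  have hG₀n : ∀ k : K, ‖G₀ k‖ = ‖D k‖ := by
    intro k
    refine hdense.induction_on (p := fun k : K => ‖G₀ k‖ = ‖D k‖) k
      (isClosed_eq (by fun_prop) (by fun_prop)) fun y => ?_
    rw [hG₀, hT]
    rfl
  refine ⟨G₀ ∘L K.orthogonalProjectionOnto, ?_, fun z => ?_⟩
  · ext y
    have : K.orthogonalProjectionOnto (D y) = e y :=
      Submodule.orthogonalProjectionOnto_mem_subspace_eq_self (e y)
    rw [mul_apply_eq_comp, ContinuousLinearMap.comp_apply, this, hG₀]
  · rw [ContinuousLinearMap.comp_apply, hG₀n]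
    have h0 : D (z - K.orthogonalProjectionOnto z) = 0 := by
      refine ext_inner_left ℂ fun v => ?_
      rw [inner_zero_right, ← ContinuousLinearMap.adjoint_inner_left, hD]
      exact (Submodule.mem_orthogonal _ _).1 (K.sub_starProjection_mem_orthogonal z) _ (hmem v)
    rw [map_sub, sub_eq_zero] at h0
    rw [h0]

/-- Take D = |T|^{1/2}. Then ‖D b‖² = ⟨b, |T| b⟩ is summable over the basis, and G inherits this
from ‖G z‖ = ‖D z‖. -/
theorem IsTraceClass.exists_factor {T : H →L[ℂ] H} (hT : IsTraceClass T) :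
    ∃ (G D : H →L[ℂ] H) (w : Set H) (b : HilbertBasis w ℂ H), T = G * D ∧
      ContinuousLinearMap.adjoint D = D ∧
      (Summable fun i => ‖D (b i)‖ ^ 2) ∧ Summable fun i => ‖G (b i)‖ ^ 2 := by
  obtain ⟨w, b, hb⟩ := hT
  let D := CFC.sqrt (CFC.abs T)
  have hD : ContinuousLinearMap.adjoint D = D :=
    (CFC.sqrt_nonneg (CFC.abs T)).isSelfAdjoint
  have hDD : D * D = CFC.abs T := CFC.sqrt_mul_sqrt_self _ (CFC.abs_nonneg T)
  obtain ⟨G, hG, hGn⟩ := exists_factor_of_norm_eq (T := T) hD fun y => by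
    rw [← mul_apply_eq_comp, hDD, norm_abs_apply]
  have hs : Summable fun i => ‖D (b i)‖ ^ 2 := by
    refine hb.congr fun i => ?_
    rw [← hDD, mul_apply_eq_comp, ← ContinuousLinearMap.adjoint_inner_left, hD,
      inner_self_eq_norm_sq_to_K]
    norm_cast
  exact ⟨G, D, w, b, hG, hD, hs, by simpa only [hGn] using hs⟩

theorem enorm_adjoint_sq_eq_tsum {ι : Type*} (b : HilbertBasis ι ℂ H) (S : H →L[ℂ] H) (x : H) :
    ‖ContinuousLinearMap.adjoint S x‖ₑ ^ 2 = ∑' i, ‖⟪S (b i), x⟫_ℂ‖ₑ ^ 2 := by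
  set y := ContinuousLinearMap.adjoint S x with hy
  have h1 : HasSum (fun i => ‖⟪S (b i), x⟫_ℂ‖ ^ 2) (‖y‖ ^ 2) := by
    have h2 := (b.hasSum_inner_mul_inner y y).mapL Complex.reCLM
    convert h2 using 1
    · ext i
      rw [hy, ContinuousLinearMap.adjoint_inner_right, ContinuousLinearMap.adjoint_inner_left,
        ← inner_conj_symm x, Complex.conj_mul']
      simp [← Complex.ofReal_pow]
    · rw [inner_self_eq_norm_sq_to_K]
      simp [← Complex.ofReal_pow]
  rw [← ofReal_norm, ← ENNReal.ofReal_pow (norm_nonneg _), ← h1.tsum_eq,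
    ENNReal.ofReal_tsum_of_nonneg (fun i => by positivity) h1.summable]
  refine tsum_congr fun i => ?_
  rw [← ofReal_norm, ← ENNReal.ofReal_pow (norm_nonneg _)]

/-- By Parseval the integrand is a sum of |⟨K* S b_i, u(v)⟩|², and the hypothesis on u bounds each
term after integration. -/
theorem lintegral_adjoint_sq_le {ι : Type*} (b : HilbertBasis ι ℂ H) {S : H →L[ℂ] H}
    (hS : Summable fun i => ‖S (b i)‖ ^ 2) {u : ℝ → H} (hu : Continuous u) {c : NNReal}
    (hc : ∀ η : H, ∫⁻ v, ‖⟪η, u v⟫_ℂ‖ₑ ^ 2 ≤ c * ‖η‖ₑ ^ 2) (K : H →L[ℂ] H) :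
    ∫⁻ v, ‖ContinuousLinearMap.adjoint S (K (u v))‖ₑ ^ 2 ≤
      c * (‖K‖ₑ ^ 2 * ENNReal.ofReal (∑' i, ‖S (b i)‖ ^ 2)) := by
  -- The basis may be uncountable, but only countably many S b_i are nonzero; countability is needed
  -- to exchange sum and integral.
  set s : Set ι := Function.support fun i => ‖S (b i)‖ ^ 2 with hs
  have hcount : Countable s := hS.countable_support.to_subtype
  have h0 : ∀ i ∉ s, S (b i) = 0 := fun i hi => by
    simpa [s] using hi
  have h1 : ∀ x, ‖ContinuousLinearMap.adjoint S x‖ₑ ^ 2 =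
      ∑' i : s, ‖⟪S (b i), x⟫_ℂ‖ₑ ^ 2 := by
    intro x
    rw [enorm_adjoint_sq_eq_tsum b S x]
    refine (tsum_subtype_eq_of_support_subset (f := fun i => ‖⟪S (b i), x⟫_ℂ‖ₑ ^ 2)
      fun i hi => ?_).symm
    by_contra h
    exact hi (by simp [h0 i h])
  have h2 : ∀ i : ι, ∫⁻ v, ‖⟪S (b i), K (u v)⟫_ℂ‖ₑ ^ 2 ≤
      c * (‖K‖ₑ ^ 2 * ENNReal.ofReal (‖S (b i)‖ ^ 2)) := by
    intro i
    simp only [← ContinuousLinearMap.adjoint_inner_left K]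
    refine (hc _).trans ?_
    rw [ENNReal.ofReal_pow (norm_nonneg _), ofReal_norm, ← mul_pow]
    gcongr
    refine (ContinuousLinearMap.le_opENorm _ _).trans ?_
    rw [← ofReal_norm (ContinuousLinearMap.adjoint K), LinearIsometryEquiv.norm_map, ofReal_norm]
  simp only [h1]
  rw [lintegral_tsum fun i => by
    have : Continuous fun v => ⟪S (b i), K (u v)⟫_ℂ :=
      continuous_const.inner (K.continuous.comp hu)
    exact (this.measurable.enorm.pow_const 2).aemeasurable]
  refine (ENNReal.tsum_le_tsum fun i : s => h2 i).trans ?_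
  rw [ENNReal.tsum_mul_left, ENNReal.tsum_mul_left]
  gcongr
  rw [ENNReal.ofReal_tsum_of_nonneg (fun i => by positivity) hS]
  exact ENNReal.tsum_comp_le_tsum_of_injective Subtype.val_injective _

/-! ### Convergence on vectors of bounded spectral density -/

theorem IsUnitaryGroupOf.continuous_apply {A : H →ₗ.[ℂ] H} {U : ℝ → H →L[ℂ] H}
    (hU : IsUnitaryGroupOf A U) {u : ℝ → H} (hu : Continuous u) :
    Continuous fun t => U t (u t) := by
  rw [continuous_iff_continuousAt]
  intro s
  rw [ContinuousAt, tendsto_iff_norm_sub_tendsto_zero]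
  have h1 : Tendsto (fun t => ‖u t - u s‖ + ‖U t (u s) - U s (u s)‖) (𝓝 s) (𝓝 0) := by
    have h2 := tendsto_iff_norm_sub_tendsto_zero.1 (hu.tendsto s)
    have h3 := tendsto_iff_norm_sub_tendsto_zero.1 ((hU.continuous (u s)).tendsto s)
    simpa using h2.add h3
  refine squeeze_zero (fun t => norm_nonneg _) (fun t => ?_) h1
  have h4 : U t (u t) - U s (u s) = U t (u t - u s) + (U t (u s) - U s (u s)) := by
    rw [map_sub]; abel
  rw [h4]
  refine (norm_add_le _ _).trans ?_
  rw [hU.norm_apply]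

theorem IsUnitaryGroupOf.hasDerivAt_neg {A : H →ₗ.[ℂ] H} {U : ℝ → H →L[ℂ] H}
    (hU : IsUnitaryGroupOf A U) (φ : A.domain) (t : ℝ) :
    HasDerivAt (fun t => U (-t) φ) (-(Complex.I • U (-t) (A φ))) t := by
  have h1 := (hU.hasDerivAt φ (-t)).scomp t (_root_.hasDerivAt_neg t)
  simpa [Function.comp_def] using h1

/-! ### The derivative of e^{iAt} J e^{-iBt} φ -/

section Cook

variable {A B : H →ₗ.[ℂ] H} {U V : ℝ → H →L[ℂ] H} {J C : H →L[ℂ] H}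

theorem hasDerivAt_inner_wave (hU : IsUnitaryGroupOf A U) (hV : IsUnitaryGroupOf B V)
    (hC : ∀ (φ : A.domain) (ψ : B.domain),
      ⟪(φ : H), C (ψ : H)⟫_ℂ = ⟪A φ, J (ψ : H)⟫_ℂ - ⟪(φ : H), J (B ψ)⟫_ℂ)
    (x : A.domain) (y : B.domain) (t : ℝ) :
    HasDerivAt (fun t => ⟪(x : H), U t (J (V (-t) y))⟫_ℂ)
      ⟪(x : H), Complex.I • U t (C (V (-t) y))⟫_ℂ t := by
  have e1 : ∀ t z, ⟪(x : H), U t z⟫_ℂ = ⟪U (-t) x, z⟫_ℂ := fun t z => by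
    rw [hU.inner_apply_left, neg_neg]
  simp only [e1, inner_smul_right]
  have h1 := (J.restrictScalars ℝ).hasFDerivAt.comp_hasDerivAt t (hV.hasDerivAt_neg y t)
  have h2 := (hU.hasDerivAt_neg x t).inner ℂ h1
  refine h2.congr_deriv ?_
  obtain ⟨u, hu, hu'⟩ := (LinearPMap.mem_graph_iff _).1 (hU.apply_mem_graph x (-t))
  obtain ⟨v, hv, hv'⟩ := (LinearPMap.mem_graph_iff _).1 (hV.apply_mem_graph y (-t))
  simp only at hu hu' hv hv'
  simp only [Function.comp, ContinuousLinearMap.coe_restrictScalars', map_neg, map_smul,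
    inner_neg_right, inner_neg_left, inner_smul_right, inner_smul_left, Complex.conj_I]
  rw [← hu', ← hv', ← hu, ← hv, hC u v]
  ring

/-- The form identity only allows differentiation when φ is in D(B), and weakly against vectors of
D(A). The integrated identity involves bounded operators alone, so it extends to all φ by density.
-/
theorem wave_sub_wave_eq_integral (hA : IsSelfAdjoint A) (hB : IsSelfAdjoint B)
    (hU : IsUnitaryGroupOf A U) (hV : IsUnitaryGroupOf B V)
    (hC : ∀ (φ : A.domain) (ψ : B.domain),
      ⟪(φ : H), C (ψ : H)⟫_ℂ = ⟪A φ, J (ψ : H)⟫_ℂ - ⟪(φ : H), J (B ψ)⟫_ℂ)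
    (φ : H) (a b : ℝ) :
    U b (J (V (-b) φ)) - U a (J (V (-a) φ)) =
      ∫ t in a..b, Complex.I • U t (C (V (-t) φ)) := by
  have hk : ∀ y, Continuous fun t => Complex.I • U t (C (V (-t) y)) := fun y =>
    (hU.continuous_apply (C.continuous.comp ((hV.continuous y).comp continuous_neg))).const_smul _
  have hdom : ∀ y : B.domain, U b (J (V (-b) y)) - U a (J (V (-a) y)) =
      ∫ t in a..b, Complex.I • U t (C (V (-t) y)) := by
    intro y
    refine hA.dense_domain.eq_of_inner_right (𝕜 := ℂ) fun x hx => ?_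
    have h1 := intervalIntegral.integral_eq_sub_of_hasDerivAt
      (fun t _ => hasDerivAt_inner_wave hU hV hC ⟨x, hx⟩ y t)
      ((continuous_const.inner (hk y)).intervalIntegrable a b)
    have h2 := (innerSL ℂ x).intervalIntegral_comp_comm
      ((hk y).intervalIntegrable (μ := volume) a b)
    simp only [innerSL_apply_apply] at h2
    rw [inner_sub_right, ← h1, ← h2]
  have hcont : Continuous fun y => ∫ t in a..b, Complex.I • U t (C (V (-t) y)) := by
    refine (LipschitzWith.of_dist_le_mul (K := ‖C‖₊ * ‖b - a‖₊) fun y z => ?_).continuous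
    rw [dist_eq_norm, dist_eq_norm, ← intervalIntegral.integral_sub
      ((hk y).intervalIntegrable a b) ((hk z).intervalIntegrable a b)]
    have h2 := intervalIntegral.norm_integral_le_of_norm_le_const (a := a) (b := b)
      (C := ‖C‖ * ‖y - z‖) (f := fun t => Complex.I • U t (C (V (-t) y)) -
        Complex.I • U t (C (V (-t) z))) fun t _ => by
      rw [← smul_sub, ← map_sub, ← map_sub, ← map_sub, norm_smul, Complex.norm_I, one_mul,
        hU.norm_apply]
      refine (C.le_opNorm _).trans ?_
      rw [hV.norm_apply]
    refine h2.trans (le_of_eq ?_)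
    simp only [NNReal.coe_mul, coe_nnnorm, Real.norm_eq_abs]
    ring
  have := Continuous.ext_on hB.dense_domain
    (f := fun y => U b (J (V (-b) y)) - U a (J (V (-a) y))) (by fun_prop) hcont
    (fun y hy => hdom ⟨y, hy⟩)
  exact congrFun this φ

theorem hasDerivAt_wave (hA : IsSelfAdjoint A) (hB : IsSelfAdjoint B)
    (hU : IsUnitaryGroupOf A U) (hV : IsUnitaryGroupOf B V)
    (hC : ∀ (φ : A.domain) (ψ : B.domain),
      ⟪(φ : H), C (ψ : H)⟫_ℂ = ⟪A φ, J (ψ : H)⟫_ℂ - ⟪(φ : H), J (B ψ)⟫_ℂ)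
    (φ : H) (t : ℝ) :
    HasDerivAt (fun t => U t (J (V (-t) φ))) (Complex.I • U t (C (V (-t) φ))) t := by
  have hk : Continuous fun t => Complex.I • U t (C (V (-t) φ)) :=
    (hU.continuous_apply (C.continuous.comp ((hV.continuous φ).comp continuous_neg))).const_smul _
  have h1 := (hk.integral_hasStrictDerivAt 0 t).hasDerivAt.const_add (U 0 (J (V (-0) φ)))
  refine h1.congr_of_eventuallyEq (Eventually.of_forall fun s => ?_)
  simp only
  rw [← wave_sub_wave_eq_integral hA hB hU hV hC φ 0 s]
  abel

end Cook

/-! ### Pearson's estimate -/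

theorem exists_tail_bound {q : ℝ → ℝ} (hq0 : ∀ x, 0 ≤ q x) (hqc : Continuous q)
    (hi : IntegrableOn q (Ioi 0)) :
    ∃ Q : ℝ → ℝ, Tendsto Q atTop (𝓝 0) ∧ ∀ s x N, 0 ≤ s → s ≤ x → 0 ≤ N →
      ∫ a in (0 : ℝ)..N, q (x + a) ≤ Q s := by
  refine ⟨fun s => (∫ y in Ioi 0, q y) - ∫ y in (0 : ℝ)..s, q y, ?_, ?_⟩
  · have := (tendsto_const_nhds (x := ∫ y in Ioi 0, q y)).sub
      (intervalIntegral_tendsto_integral_Ioi 0 hi tendsto_id)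
    simpa using this
  · intro s x N hs hx hN
    have hii : ∀ a b, IntervalIntegrable q volume a b := fun a b => hqc.intervalIntegrable a b
    have h1 : ∫ a in (0 : ℝ)..N, q (x + a) = ∫ y in x..(x + N), q y := by
      rw [intervalIntegral.integral_comp_add_left q x, add_zero]
    have h2 : ∫ y in (0 : ℝ)..(x + N), q y ≤ ∫ y in Ioi 0, q y := by
      rw [intervalIntegral.integral_of_le (by linarith)]
      exact setIntegral_mono_set hi (ae_of_all _ hq0) Ioc_subset_Ioi_self.eventuallyLE
    have h3 : 0 ≤ ∫ y in s..x, q y := intervalIntegral.integral_nonneg hx fun y _ => hq0 y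
    have h4 := intervalIntegral.integral_add_adjacent_intervals (hii 0 s) (hii s x)
    have h5 := intervalIntegral.integral_add_adjacent_intervals (hii 0 x) (hii x (x + N))
    rw [h1]
    linarith

/-- Replaces the Cauchy-Schwarz inequality in time: integrated, it pairs a bounded quantity of
weight ε with a small tail of weight ε⁻¹. -/
theorem mul_le_mul_sq_add_inv_mul_sq {a b ε : ℝ} (hε : 0 < ε) :
    a * b ≤ ε * a ^ 2 + ε⁻¹ * b ^ 2 := by
  have h1 : 0 ≤ ε⁻¹ * ((ε * a - b) ^ 2 + (ε * a) ^ 2 + b ^ 2) / 2 := by positivity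
  have h2 : ε⁻¹ * ((ε * a - b) ^ 2 + (ε * a) ^ 2 + b ^ 2) / 2 =
      ε * a ^ 2 + ε⁻¹ * b ^ 2 - a * b := by
    field_simp
    ring
  linarith

/-- An abstract form of the convergence criterion for a differentiable curve `w` in a Hilbert
space with `w' = i k`. -/
theorem exists_tendsto_of_inner_bound {w k : ℝ → H} (hk : Continuous k)
    (hw : ∀ t, HasDerivAt w (Complex.I • k t) t)
    {p : ℝ → ℝ → ℝ} {q r : ℝ → ℝ} {P M g : ℝ} (hp : ∀ δ, Continuous (p δ)) (hq : Continuous q)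
    (hr : Continuous r) (hq0 : ∀ x, 0 ≤ q x) (hr0 : ∀ x, 0 ≤ r x)
    (hM : 0 ≤ M) (hg : 0 ≤ g)
    (hpP : ∀ δ x N, 0 ≤ N → ∫ a in (0 : ℝ)..N, p δ (x + a) ≤ P)
    (hqi : IntegrableOn q (Ioi 0)) (hri : IntegrableOn r (Ioi 0))
    (hkn : ∀ y ε, 0 < ε → ‖k y‖ ≤ g * (ε + ε⁻¹ * q y) + r y)
    (hin : ∀ x y ε, 0 < ε → ‖⟪w x, k y⟫_ℂ‖ ≤ ε * p (x - y) x + ε⁻¹ * q y + M * r y) :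
    ∃ z, Tendsto w atTop (𝓝 z) := by
  obtain ⟨Q, hQ, hQb⟩ := exists_tail_bound hq0 hq hqi
  obtain ⟨R, hR, hRb⟩ := exists_tail_bound hr0 hr hri
  have hwc : Continuous w := continuous_iff_continuousAt.2 fun t => (hw t).continuousAt
  -- The integral of one term of the derivative of `‖w (t + a) - w (s + a)‖ ^ 2`.
  have hterm : ∀ s x y N ε, 0 ≤ s → s ≤ y → 0 ≤ N → 0 < ε →
      ∫ a in (0 : ℝ)..N, ‖⟪w (x + a), k (y + a)⟫_ℂ‖ ≤ ε * P + ε⁻¹ * Q s + M * R s := by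
    intro s x y N ε hs hy hN hε
    have c1 : Continuous fun a : ℝ => ‖⟪w (x + a), k (y + a)⟫_ℂ‖ := by fun_prop
    have c2 : Continuous fun a : ℝ => ε * p (x - y) (x + a) := by
      have := hp (x - y)
      fun_prop
    have c3 : Continuous fun a : ℝ => ε⁻¹ * q (y + a) := by fun_prop
    have c4 : Continuous fun a : ℝ => M * r (y + a) := by fun_prop
    calc ∫ a in (0 : ℝ)..N, ‖⟪w (x + a), k (y + a)⟫_ℂ‖
        ≤ ∫ a in (0 : ℝ)..N, (ε * p (x - y) (x + a) + ε⁻¹ * q (y + a) + M * r (y + a)) := by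
          refine intervalIntegral.integral_mono_on hN (c1.intervalIntegrable _ _)
            (((c2.add c3).add c4).intervalIntegrable _ _) fun a _ => ?_
          have := hin (x + a) (y + a) ε hε
          -- The common shift a leaves x - y unchanged, so a single function p (x - y) is
          -- integrated.
          rwa [add_sub_add_right_eq_sub] at this
      _ = ε * (∫ a in (0 : ℝ)..N, p (x - y) (x + a)) + ε⁻¹ * (∫ a in (0 : ℝ)..N, q (y + a)) +
            M * ∫ a in (0 : ℝ)..N, r (y + a) := by
          have c23 : Continuous fun a : ℝ => ε * p (x - y) (x + a) + ε⁻¹ * q (y + a) := c2.add c3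
          rw [intervalIntegral.integral_add (c23.intervalIntegrable _ _)
            (c4.intervalIntegrable _ _), intervalIntegral.integral_add (c2.intervalIntegrable _ _)
            (c3.intervalIntegrable _ _), intervalIntegral.integral_const_mul,
            intervalIntegral.integral_const_mul, intervalIntegral.integral_const_mul]
      _ ≤ ε * P + ε⁻¹ * Q s + M * R s := by
          have := hpP (x - y) x N hN
          have := hQb s y N hs hy hN
          have := hRb s y N hs hy hN
          gcongr
  -- Pearson's trick: go from (s, t) to (s + N, t + N) and integrate the derivative of the squared
  -- distance. Expanding it gives four inner products, each bounded by `hterm`; the factor 8 is 2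
  -- times 4.
  have hdiff : ∀ s t N ε, 0 ≤ s → s ≤ t → 0 ≤ N → 0 < ε →
      ‖w t - w s‖ ^ 2 ≤ ‖w (t + N) - w (s + N)‖ ^ 2 + 8 * (ε * P + ε⁻¹ * Q s + M * R s) := by
    intro s t N ε hs hst hN hε
    let h' : ℝ → ℝ := fun a => 2 * (⟪w (t + a) - w (s + a),
      Complex.I • k (t + a) - Complex.I • k (s + a)⟫_ℂ).re
    have hd : ∀ a, HasDerivAt (fun a => ‖w (t + a) - w (s + a)‖ ^ 2) (h' a) a := by
      intro a
      have h1 : HasDerivAt (fun a => w (t + a) - w (s + a))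
          (Complex.I • k (t + a) - Complex.I • k (s + a)) a :=
        ((hw (t + a)).comp_const_add t a).sub ((hw (s + a)).comp_const_add s a)
      let _ : InnerProductSpace ℝ H := InnerProductSpace.rclikeToReal ℂ H
      have h2 := h1.norm_sq
      exact h2
    have hc' : Continuous h' := by
      refine continuous_const.mul (Complex.continuous_re.comp ?_)
      fun_prop
    have h3 := intervalIntegral.integral_eq_sub_of_hasDerivAt (fun a _ => hd a)
      (hc'.intervalIntegrable 0 N)
    simp only [add_zero] at h3
    have cont : ∀ x y : ℝ, IntervalIntegrable (fun a : ℝ => ‖⟪w (x + a), k (y + a)⟫_ℂ‖) volume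
        0 N := fun x y => by
      have : Continuous fun a : ℝ => ‖⟪w (x + a), k (y + a)⟫_ℂ‖ := by fun_prop
      exact this.intervalIntegrable _ _
    have h4 : ∫ a in (0 : ℝ)..N, -h' a ≤ ∫ a in (0 : ℝ)..N,
        2 * ((‖⟪w (t + a), k (t + a)⟫_ℂ‖ + ‖⟪w (t + a), k (s + a)⟫_ℂ‖) +
          (‖⟪w (s + a), k (t + a)⟫_ℂ‖ + ‖⟪w (s + a), k (s + a)⟫_ℂ‖)) := by
      refine intervalIntegral.integral_mono_on hN (hc'.neg.intervalIntegrable _ _)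
        ((((cont t t).add (cont t s)).add ((cont s t).add (cont s s))).const_mul 2) fun a _ => ?_
      have h5 : -h' a = 2 * -(⟪w (t + a) - w (s + a),
          Complex.I • k (t + a) - Complex.I • k (s + a)⟫_ℂ).re := by
        simp only [h']; ring
      rw [h5]
      refine mul_le_mul_of_nonneg_left ?_ (by norm_num)
      refine (neg_le_abs _).trans ((Complex.abs_re_le_norm _).trans ?_)
      rw [← smul_sub, inner_smul_right, norm_mul, Complex.norm_I, one_mul, inner_sub_left,
        inner_sub_right, inner_sub_right]
      exact (norm_sub_le _ _).trans (add_le_add (norm_sub_le _ _) (norm_sub_le _ _))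
    rw [intervalIntegral.integral_neg, h3, intervalIntegral.integral_const_mul,
      intervalIntegral.integral_add ((cont t t).add (cont t s)) ((cont s t).add (cont s s)),
      intervalIntegral.integral_add (cont t t) (cont t s),
      intervalIntegral.integral_add (cont s t) (cont s s)] at h4
    have b1 := hterm s t t N ε hs hst hN hε
    have b2 := hterm s t s N ε hs le_rfl hN hε
    have b3 := hterm s s t N ε hs hst hN hε
    have b4 := hterm s s s N ε hs le_rfl hN hε
    linarith
  -- For fixed t - s the right side tends to g ε (t - s) as N grows, and ε is arbitrary; so the
  -- shifted difference vanishes in the limit.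
  have hnear : ∀ s t N ε, 0 ≤ s → s ≤ t → 0 ≤ N → 0 < ε →
      ‖w (t + N) - w (s + N)‖ ≤ g * (ε * (t - s) + ε⁻¹ * Q (s + N)) + R (s + N) := by
    intro s t N ε hs hst hN hε
    have hkI : Continuous fun y => Complex.I • k y := by fun_prop
    have h1 := intervalIntegral.integral_eq_sub_of_hasDerivAt (fun y _ => hw y)
      (hkI.intervalIntegrable (s + N) (t + N))
    rw [← h1]
    have c1 : Continuous fun y => ε + ε⁻¹ * q y := by fun_prop
    have h2 := intervalIntegral.norm_integral_le_of_norm_le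
      (f := fun y => Complex.I • k y) (g := fun y => g * (ε + ε⁻¹ * q y) + r y)
      (a := s + N) (b := t + N) (μ := volume) (by linarith)
      (ae_of_all _ fun y _ => by
        rw [norm_smul, Complex.norm_I, one_mul]; exact hkn y ε hε)
      (((c1.const_mul g).add hr).intervalIntegrable _ _)
    refine h2.trans ?_
    have c2 : Continuous fun y => ε⁻¹ * q y := by fun_prop
    rw [intervalIntegral.integral_add ((c1.const_mul g).intervalIntegrable _ _)
      (hr.intervalIntegrable _ _), intervalIntegral.integral_const_mul,
      intervalIntegral.integral_add intervalIntegrable_const (c2.intervalIntegrable _ _),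
      intervalIntegral.integral_const_mul, intervalIntegral.integral_const]
    have e : ∀ f : ℝ → ℝ, ∫ y in (s + N)..(t + N), f y =
        ∫ a in (0 : ℝ)..(t - s), f ((s + N) + a) := by
      intro f
      rw [intervalIntegral.integral_comp_add_left f (s + N)]
      congr 1 <;> ring
    rw [e q, e r]
    have b1 := hQb (s + N) (s + N) (t - s) (by linarith) le_rfl (by linarith)
    have b2 := hRb (s + N) (s + N) (t - s) (by linarith) le_rfl (by linarith)
    have e2 : (t + N - (s + N)) • ε = ε * (t - s) := by rw [smul_eq_mul]; ring
    rw [e2]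
    gcongr
  have hfinal : ∀ s t ε, 0 ≤ s → s ≤ t → 0 < ε →
      ‖w t - w s‖ ^ 2 ≤ 8 * (ε * P + ε⁻¹ * Q s + M * R s) := by
    intro s t ε hs hst hε
    have h1 : ∀ ε', 0 < ε' →
        ‖w t - w s‖ ^ 2 ≤ (g * (ε' * (t - s))) ^ 2 + 8 * (ε * P + ε⁻¹ * Q s + M * R s) := by
      intro ε' hε'
      have hsN : Tendsto (fun N => s + N) atTop atTop := tendsto_atTop_add_const_left _ s tendsto_id
      have h2 : Tendsto (fun N => (g * (ε' * (t - s) + ε'⁻¹ * Q (s + N)) + R (s + N)) ^ 2 +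
          8 * (ε * P + ε⁻¹ * Q s + M * R s)) atTop
          (𝓝 ((g * (ε' * (t - s) + ε'⁻¹ * 0) + 0) ^ 2 + 8 * (ε * P + ε⁻¹ * Q s + M * R s))) :=
        ((((((hQ.comp hsN).const_mul _).const_add _).const_mul g).add (hR.comp hsN)).pow
          2).add_const _
      have h3 := ge_of_tendsto h2 (b := ‖w t - w s‖ ^ 2) (by
        filter_upwards [Ici_mem_atTop 0] with N hN
        refine (hdiff s t N ε hs hst hN hε).trans ?_
        gcongr
        exact hnear s t N ε' hs hst hN hε')
      simpa using h3
    have h4 : Tendsto (fun ε' : ℝ => (g * (ε' * (t - s))) ^ 2 +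
        8 * (ε * P + ε⁻¹ * Q s + M * R s)) (𝓝[>] 0)
        (𝓝 ((g * (0 * (t - s))) ^ 2 + 8 * (ε * P + ε⁻¹ * Q s + M * R s))) := by
      have : Continuous fun ε' : ℝ => (g * (ε' * (t - s))) ^ 2 +
        8 * (ε * P + ε⁻¹ * Q s + M * R s) := by fun_prop
      exact (this.tendsto 0).mono_left nhdsWithin_le_nhds
    have h5 := ge_of_tendsto h4 (b := ‖w t - w s‖ ^ 2) (by
      filter_upwards [self_mem_nhdsWithin] with ε' hε'
      exact h1 ε' hε')
    simpa using h5
  have hcau : CauchySeq w := by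
    rw [Metric.cauchySeq_iff']
    intro η hη
    have hP : 0 ≤ P := by simpa using hpP 0 0 0 le_rfl
    -- This makes 8 ε P at most η²/2; adding 1 to P covers the case P = 0.
    set ε := η ^ 2 / (16 * (P + 1)) with hε
    have hε0 : 0 < ε := by positivity
    have h1 : Tendsto (fun s => 8 * (ε * P + ε⁻¹ * Q s + M * R s)) atTop
        (𝓝 (8 * (ε * P + ε⁻¹ * 0 + M * 0))) :=
      (((hQ.const_mul _).const_add _).add (hR.const_mul _)).const_mul _
    have h2 : 8 * (ε * P + ε⁻¹ * 0 + M * 0) < η ^ 2 := by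
      have h3 : ε * (16 * (P + 1)) = η ^ 2 := by
        rw [hε]; field_simp
      nlinarith [mul_nonneg hε0.le hP]
    obtain ⟨s, hs, hs0⟩ := ((h1.eventually (gt_mem_nhds h2)).and (Ici_mem_atTop (0 : ℝ))).exists
    refine ⟨s, fun t ht => ?_⟩
    rw [dist_eq_norm]
    have h4 := (hfinal s t ε hs0 ht hε0).trans_lt hs
    exact lt_of_pow_lt_pow_left₀ 2 hη.le h4
  exact cauchySeq_tendsto_of_complete hcau

theorem integrable_norm_sq_of_lintegral_le {u : ℝ → H} (hu : Continuous u) {c : ℝ≥0∞}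
    (hc : c ≠ ∞) (h : ∫⁻ v, ‖u v‖ₑ ^ 2 ≤ c) :
    Integrable (fun v => ‖u v‖ ^ 2) ∧ ∫ v, ‖u v‖ ^ 2 ≤ c.toReal := by
  have e : ∀ v, ENNReal.ofReal (‖u v‖ ^ 2) = ‖u v‖ₑ ^ 2 := fun v => by
    rw [ENNReal.ofReal_pow (norm_nonneg _), ofReal_norm]
  constructor
  · refine ⟨by fun_prop, ?_⟩
    rw [hasFiniteIntegral_iff_ofReal (ae_of_all _ fun v => by positivity)]
    simp only [e]
    exact h.trans_lt hc.lt_top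
  · rw [integral_eq_lintegral_of_nonneg_ae (ae_of_all _ fun v => by positivity) (by fun_prop)]
    simp only [e]
    exact ENNReal.toReal_mono hc h

theorem exists_tendsto_wave_of_mem {A B : H →ₗ.[ℂ] H} (hA : IsSelfAdjoint A)
    (hB : IsSelfAdjoint B) {J C C₁ C₂ : H →L[ℂ] H}
    (hC : ∀ (φ : A.domain) (ψ : B.domain),
      ⟪(φ : H), C (ψ : H)⟫_ℂ = ⟪A φ, J (ψ : H)⟫_ℂ - ⟪(φ : H), J (B ψ)⟫_ℂ)
    (hsplit : C = C₁ + C₂) (hC₁ : IsTraceClass C₁) {φ : H} (hφ : φ ∈ boundedDensitySet B)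
    (hint : IntegrableOn (fun t : ℝ => ‖C₂ (expI B (-t) φ)‖) (Ioi 0)) :
    ∃ z, Tendsto (fun t => expI A t (J (expI B (-t) φ))) atTop (𝓝 z) := by
  have hU := isUnitaryGroupOf_expI_of_isSelfAdjoint hA
  have hV := isUnitaryGroupOf_expI_of_isSelfAdjoint hB
  obtain ⟨G, D, w, b, hGD, hD, hDs, hGs⟩ := hC₁.exists_factor
  obtain ⟨c, hc⟩ := lintegral_inner_expI_sq_le hB hφ
  have hu : Continuous fun v => expI B (-v) φ := (hV.continuous φ).comp continuous_neg
  set u : ℝ → H := fun v => expI B (-v) φ with hudef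
  have hCu : ∀ y, C (u y) = G (D (u y)) + C₂ (u y) := fun y => by
    rw [hsplit, hGD]; rfl
  -- The first argument is the time difference x - y. Unitarity of e^{iAδ} makes the bound `Pₑ` on
  -- its integral independent of δ.
  let p : ℝ → ℝ → ℝ := fun δ x => ‖ContinuousLinearMap.adjoint G (expI A δ (J (u x)))‖ ^ 2
  let q : ℝ → ℝ := fun y => ‖D (u y)‖ ^ 2
  let r : ℝ → ℝ := fun y => ‖C₂ (u y)‖
  set Pₑ : ℝ≥0∞ := c * (‖J‖ₑ ^ 2 * ENNReal.ofReal (∑' i, ‖G (b i)‖ ^ 2)) with hPe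
  have hPfin : Pₑ ≠ ∞ := by finiteness
  have hp : ∀ δ, Integrable (p δ) ∧ ∫ v, p δ v ≤ Pₑ.toReal := by
    intro δ
    refine integrable_norm_sq_of_lintegral_le (by fun_prop) hPfin ?_
    refine (lintegral_adjoint_sq_le b hGs hu hc (expI A δ * J)).trans ?_
    rw [hPe]
    have h1 : ‖expI A δ * J‖ₑ ≤ ‖J‖ₑ := by
      rw [← ofReal_norm, ← ofReal_norm]
      refine ENNReal.ofReal_le_ofReal (ContinuousLinearMap.opNorm_le_bound _ (norm_nonneg _)
        fun x => ?_)
      rw [mul_apply_eq_comp, hU.norm_apply]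
      exact J.le_opNorm x
    gcongr
  have hq : Integrable q := by
    refine (integrable_norm_sq_of_lintegral_le (u := fun y => D (u y)) (by fun_prop)
      (c := c * (‖(1 : H →L[ℂ] H)‖ₑ ^ 2 * ENNReal.ofReal (∑' i, ‖D (b i)‖ ^ 2)))
      (by finiteness) ?_).1
    have := lintegral_adjoint_sq_le b hDs hu hc 1
    rw [hD] at this
    exact this
  refine exists_tendsto_of_inner_bound (k := fun t => expI A t (C (u t))) (p := p) (q := q)
    (r := r) (P := Pₑ.toReal) (M := ‖J‖ * ‖φ‖) (g := ‖G‖)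
    (hU.continuous_apply (by fun_prop)) (hasDerivAt_wave hA hB hU hV hC φ)
    (fun δ => by fun_prop) (by fun_prop) (by fun_prop) (fun x => by positivity)
    (fun x => norm_nonneg _) (by positivity) (norm_nonneg _) ?_ hq.integrableOn hint ?_ ?_
  · intro δ x N hN
    rw [intervalIntegral.integral_comp_add_left (p δ) x, intervalIntegral.integral_of_le
      (by linarith)]
    exact (setIntegral_le_integral (hp δ).1 (ae_of_all _ fun v => by positivity)).trans (hp δ).2
  · intro y ε hε
    rw [hU.norm_apply, hCu]
    refine (norm_add_le _ _).trans (add_le_add ?_ le_rfl)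
    refine (G.le_opNorm _).trans (mul_le_mul_of_nonneg_left ?_ (norm_nonneg _))
    have := mul_le_mul_sq_add_inv_mul_sq (a := 1) (b := ‖D (u y)‖) hε
    simpa using this
  · intro x y ε hε
    -- Cancelling the common factor e^{iAy} leaves only the time difference on the A side.
    have h1 : ⟪expI A x (J (u x)), expI A y (C (u y))⟫_ℂ =
        ⟪ContinuousLinearMap.adjoint G (expI A (x - y) (J (u x))), D (u y)⟫_ℂ +
          ⟪expI A (x - y) (J (u x)), C₂ (u y)⟫_ℂ := by
      have h2 : expI A x (J (u x)) = expI A y (expI A (x - y) (J (u x))) := by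
        rw [← hU.apply_add, add_sub_cancel]
      rw [h2, hU.inner_map_map, hCu, inner_add_right, ContinuousLinearMap.adjoint_inner_left]
    rw [h1]
    refine (norm_add_le _ _).trans (add_le_add ?_ ?_)
    · exact (norm_inner_le_norm _ _).trans (mul_le_mul_sq_add_inv_mul_sq hε)
    · refine (norm_inner_le_norm _ _).trans (mul_le_mul_of_nonneg_right ?_ (norm_nonneg _))
      rw [hU.norm_apply]
      refine (J.le_opNorm _).trans (le_of_eq ?_)
      rw [hudef, hV.norm_apply]

/-! ### Density of the vectors of bounded spectral density -/

theorem norm_sub_proj_sq (E : ProjMeasure H) {S : Set ℝ} (hS : MeasurableSet S) (φ : H) :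
    ‖φ - E.proj S φ‖ ^ 2 = (E.scalar φ).real Sᶜ := by
  have h1 : E.proj S φ + E.proj Sᶜ φ = φ := by
    have := E.proj_union hS hS.compl disjoint_compl_right
    rw [union_compl_self, E.univ] at this
    exact (congrArg (fun T : H →L[ℂ] H => T φ) this).symm
  have h2 : φ - E.proj S φ = E.proj Sᶜ φ := by
    rw [sub_eq_iff_eq_add, add_comm]; exact h1.symm
  rw [h2, Measure.real, E.scalar_apply_eq_enorm φ hS.compl]
  simp

/-- Let h be the spectral density of φ and S_n the set where h ≤ n. Then E(S_n)φ has density at most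
n, and it converges to φ because h is finite almost everywhere. -/
theorem acSubspace_subset_closure (B : H →ₗ.[ℂ] H) :
    (acSubspace B : Set H) ⊆ closure (boundedDensitySet B) := by
  intro φ hφ
  set E := spectralMeasure B with hE
  have hac : E.scalar φ ≪ volume := hφ
  set h := (E.scalar φ).rnDeriv volume with hh
  have hm : Measurable h := Measure.measurable_rnDeriv _ _
  let S : ℕ → Set ℝ := fun n => {x | h x ≤ n}
  have hS : ∀ n, MeasurableSet (S n) := fun n => measurableSet_le hm measurable_const
  have hdens : volume.withDensity h = E.scalar φ := Measure.withDensity_rnDeriv_eq _ _ hac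
  refine mem_closure_of_tendsto (f := fun n => E.proj (S n) φ) (b := atTop) ?_
    (Eventually.of_forall fun n => ?_)
  · rw [tendsto_iff_norm_sub_tendsto_zero]
    have hmono : Antitone fun n => (S n)ᶜ := fun m n hmn => compl_subset_compl.2
      fun x (hx : h x ≤ m) => hx.trans (by exact_mod_cast hmn)
    have h1 := tendsto_measure_iInter_atTop (μ := E.scalar φ)
      (fun n => (hS n).compl.nullMeasurableSet) hmono ⟨0, measure_ne_top _ _⟩
    have h2 : E.scalar φ (⋂ n, (S n)ᶜ) = 0 := by
      refine hac ?_
      have hfin : ∀ᵐ x, h x < ∞ := Measure.rnDeriv_lt_top _ _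
      refine measure_mono_null (fun x hx => ?_) hfin
      rw [mem_iInter] at hx
      intro hlt
      obtain ⟨n, hn⟩ := ENNReal.exists_nat_gt (ne_of_lt hlt)
      exact hx n hn.le
    rw [h2] at h1
    have h3 := (ENNReal.tendsto_toReal ENNReal.zero_ne_top).comp h1
    have h4 : Tendsto (fun n => ‖E.proj (S n) φ - φ‖ ^ 2) atTop (𝓝 0) := by
      refine h3.congr fun n => ?_
      rw [norm_sub_rev, norm_sub_proj_sq E (hS n)]
      rfl
    simpa using h4.sqrt
  · have hle : ∀ x, (S n).indicator h x ≤ n := fun x => by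
      by_cases hx : x ∈ S n
      · rw [indicator_of_mem hx]; exact hx
      · rw [indicator_of_notMem hx]; exact zero_le
    refine ⟨fun x => (Real.sqrt ((S n).indicator h x).toReal : ℂ), ?_, ?_⟩
    · refine memLp_top_of_bound ?_ (Real.sqrt n) (ae_of_all _ fun x => ?_)
      · exact (Complex.measurable_ofReal.comp
          ((hm.indicator (hS n)).ennreal_toReal.sqrt)).aestronglyMeasurable
      · rw [Complex.norm_real, Real.norm_of_nonneg (Real.sqrt_nonneg _)]
        refine Real.sqrt_le_sqrt ?_
        exact ENNReal.toReal_le_of_le_ofReal (by positivity) (by simpa using hle x)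
    · rw [E.scalar_proj (hS n), ← hdens, restrict_withDensity (hS n),
        ← withDensity_indicator (hS n)]
      congr 1
      ext x
      rw [← ofReal_norm, ← ENNReal.ofReal_pow (norm_nonneg _), Complex.norm_real,
        Real.norm_of_nonneg (Real.sqrt_nonneg _), Real.sq_sqrt ENNReal.toReal_nonneg,
        ENNReal.ofReal_toReal ((hle x).trans_lt (ENNReal.natCast_lt_top n)).ne]

/-- An ε/3 argument: the uniform bound transfers the Cauchy property from M to its closure. -/
theorem exists_tendsto_of_mem_closure {W : ℝ → H →L[ℂ] H} {c : ℝ}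
    (hW : ∀ t x, ‖W t x‖ ≤ c * ‖x‖) {M : Set H}
    (hM : ∀ φ ∈ M, ∃ z, Tendsto (fun t => W t φ) atTop (𝓝 z)) {φ : H} (hφ : φ ∈ closure M) :
    ∃ z, Tendsto (fun t => W t φ) atTop (𝓝 z) := by
  refine cauchySeq_tendsto_of_complete ?_
  rw [Metric.cauchySeq_iff']
  intro ε hε
  obtain ⟨ψ, hψ, hd⟩ := Metric.mem_closure_iff.1 hφ (ε / (3 * (|c| + 1))) (by positivity)
  obtain ⟨z, hz⟩ := hM ψ hψ
  obtain ⟨N, hN⟩ := Metric.cauchySeq_iff'.1 hz.cauchySeq (ε / 3) (by positivity)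
  refine ⟨N, fun n hn => ?_⟩
  have h1 : ∀ t, dist (W t φ) (W t ψ) < ε / 3 := by
    intro t
    rw [dist_eq_norm, ← map_sub]
    rw [dist_eq_norm, lt_div_iff₀ (by positivity)] at hd
    have h2 : c * ‖φ - ψ‖ ≤ |c| * ‖φ - ψ‖ :=
      mul_le_mul_of_nonneg_right (le_abs_self c) (norm_nonneg _)
    refine (hW t _).trans_lt ?_
    nlinarith [norm_nonneg (φ - ψ)]
  calc dist (W n φ) (W N φ) ≤ dist (W n φ) (W n ψ) + dist (W n ψ) (W N ψ) +
        dist (W N ψ) (W N φ) := dist_triangle4 _ _ _ _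
    _ < ε / 3 + ε / 3 + ε / 3 := by
        have h3 := h1 N
        rw [dist_comm] at h3
        exact add_lt_add (add_lt_add (h1 n) (hN n hn)) h3
    _ = ε := by ring

theorem exists_strong_limit {W : ℝ → H →L[ℂ] H} {c : ℝ} (hW : ∀ t x, ‖W t x‖ ≤ c * ‖x‖)
    (h : ∀ φ, ∃ z, Tendsto (fun t => W t φ) atTop (𝓝 z)) :
    ∃ Ω : H →L[ℂ] H, ∀ φ, Tendsto (fun t => W t φ) atTop (𝓝 (Ω φ)) := by
  choose L hL using h
  let L₀ : H →ₗ[ℂ] H :=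
    { toFun := L
      map_add' := fun φ ψ => tendsto_nhds_unique (hL (φ + ψ)) (by
        simpa using (hL φ).add (hL ψ))
      map_smul' := fun a φ => tendsto_nhds_unique (hL (a • φ)) (by
        simpa using (hL φ).const_smul a) }
  exact ⟨L₀.mkContinuous c fun φ => le_of_tendsto (hL φ).norm
    (Eventually.of_forall fun t => hW t φ), hL⟩

end Scattering

end

theorem mainTheorem6 {H : Type*} [NormedAddCommGroup H] [InnerProductSpace ℂ H] [CompleteSpace H]
    (A B : H →ₗ.[ℂ] H) (hA : IsSelfAdjoint A) (hB : IsSelfAdjoint B)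
    (J C C₁ C₂ : H →L[ℂ] H)
    (hC : ∀ (φ : A.domain) (ψ : B.domain),
      inner ℂ (φ : H) (C (ψ : H)) = inner ℂ (A φ) (J (ψ : H)) - inner ℂ (φ : H) (J (B ψ)))
    (hsplit : C = C₁ + C₂)
    (hC₁ : Scattering.IsTraceClass C₁)
    (M : Set H) (hM : M ⊆ Scattering.boundedDensitySet B)
    (hMdense : Scattering.boundedDensitySet B ⊆ closure M)
    (hlim : ∀ φ ∈ M,
      Filter.Tendsto (fun t : ℝ => C₂ (Scattering.expI B (-t) φ)) Filter.atTop (nhds 0))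
    (hint : ∀ φ ∈ M,
      MeasureTheory.IntegrableOn (fun t : ℝ => ‖C₂ (Scattering.expI B (-t) φ)‖) (Set.Ioi 0)) :
    ∃ Ω : H →L[ℂ] H, ∀ φ : H,
      Filter.Tendsto
        (fun t : ℝ => Scattering.expI A t (J (Scattering.expI B (-t) (Scattering.acProj B φ))))
        Filter.atTop (nhds (Ω φ)) := by
  have hU := Scattering.isUnitaryGroupOf_expI_of_isSelfAdjoint hA
  have hV := Scattering.isUnitaryGroupOf_expI_of_isSelfAdjoint hB
  have hW : ∀ t x, ‖(Scattering.expI A t * J * Scattering.expI B (-t)) x‖ ≤ ‖J‖ * ‖x‖ := by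
    intro t x
    change ‖Scattering.expI A t (J (Scattering.expI B (-t) x))‖ ≤ ‖J‖ * ‖x‖
    rw [hU.norm_apply, ← hV.norm_apply (-t) x]
    exact J.le_opNorm _
  refine Scattering.exists_strong_limit (c := ‖J‖)
    (W := fun t => Scattering.expI A t * J * Scattering.expI B (-t) * Scattering.acProj B)
    (fun t φ => (hW t _).trans (mul_le_mul_of_nonneg_left
      (Submodule.norm_starProjection_apply_le _ φ) (norm_nonneg _))) fun φ => ?_
  refine Scattering.exists_tendsto_of_mem_closure hW (M := M) (fun ψ hψ =>
    Scattering.exists_tendsto_wave_of_mem hA hB hC hsplit hC₁ (hM hψ) (hint ψ hψ)) ?_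
  have hφ : Scattering.acProj B φ ∈ closure (Scattering.boundedDensitySet B) :=
    Scattering.acSubspace_subset_closure B (Submodule.starProjection_apply_mem _ φ)
  exact closure_minimal hMdense isClosed_closure hφ
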